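/- Let $b\ge 2$ be an integer and let $\rho$ be a Borel probability measure on $[0,1]$ that is absolutely continuous with respect to Lebesgue measure, has a bounded density (in $L^\infty$), and satisfies $\rho([1-\tfrac1b,1])>0$. Let $\mathbb P=\rho^{\mathbb N}$ be the law on $[0,1]^{\mathbb N}$ of an i.i.d. sequence $Y=(Y_1,Y_2,\dots)$ with common law $\rho$. For $\theta\ge1$ and $1\le k\le n$ put $$Q_{n,k}^{(\theta)}=Y_k+\frac{Y_{k+1}}{b}+\dots+\frac{Y_n}{b^{n-k}}+\frac{\theta}{b^{n-k+1}},\qquad \mathbb P_n^{(\theta)}(\,\cdot\,)=\mathbb P\bigl(\,\cdot\,\big|\,Q_{n,\ell}^{(\theta)}\ge1,\ \ell=2,\dots,n\bigr).$$ Then there is a unique probability measure $\widehat{\mathbb P}$ on $[0,1]^{\mathbb N}$ such that, for every $\theta\ge1$ and every event $A$ depending on finitely many coordinates, $\widehat{\mathbb P}(A)=\lim_{n\to\infty}\mathbb P_n^{(\theta)}(A)$. Let $Q_\infty=\sum_{k\ge1}Y_k\,b^{-(k-1)}$ under $\widehat{\mathbb P}$, and let $X$ be a random variable with law $\rho$,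 independent of $Q_\infty$. Then $\widehat{\mathbb P}(Q_\infty\ge1)>0$, and the law of $X+Q_\infty/b$ conditioned on $Q_\infty\ge1$ equals the law of $Q_\infty$: $$\rho\otimes\widehat{\mathbb P}\Bigl(X+\frac{Q_\infty}{b}\in\cdot\,\Big|\,Q_\infty\ge1\Bigr)=\widehat{\mathbb P}(Q_\infty\in\cdot\,).$$ -/

import Mathlib

open MeasureTheory ProbabilityTheory Filter Topology
open scoped unitInterval ENNReal

namespace Avalanche

/-- Membership of a Borel probability measure `ρ` on `[0,1]` in the class of those that are absolutely continuous with respect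
to Lebesgue measure on `[0,1]` (this is `volume` on `unitInterval`) with an essentially bounded
density, and that give positive mass to `[1 - 1/b, 1]`. -/
structure MFlat (b : ℕ) (ρ : Measure I) [IsProbabilityMeasure ρ] : Prop where
  absolutelyContinuous : ρ ≪ volume
  density_bounded : essSup (ρ.rnDeriv volume) volume < ∞
  mass_pos : 0 < ρ {x : I | 1 - 1 / (b : ℝ) ≤ (x : ℝ)}

/-- The law of an i.i.d. sequence of `ρ`-distributed variables. The coordinates are numbered from
zero: for `y : ℕ → I`, the variable `Y_{k+1}` of the one-based numbering is `y k`. -/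
noncomputable def iidLaw (ρ : Measure I) [IsProbabilityMeasure ρ] : Measure (ℕ → I) :=
  Measure.infinitePi (fun _ : ℕ => ρ)

/-- For `k ≤ n`, the quantity
`y k + y (k+1) / b + ⋯ + y (n-1) / b ^ (n-1-k) + θ / b ^ (n-k)`.
In the one-based numbering this is
`Q_{n,k+1} = Y_{k+1} + Y_{k+2} / b + ⋯ + Y_n / b ^ (n-k-1) + θ / b ^ (n-k)`. -/
noncomputable def Q (b : ℕ) (θ : ℝ) (n k : ℕ) (y : ℕ → I) : ℝ :=
  (∑ i ∈ Finset.range (n - k), (y (k + i) : ℝ) / (b : ℝ) ^ i) + θ / (b : ℝ) ^ (n - k)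

/-- The event that `Q_{n,ℓ} ≥ 1` for all `ℓ = 2, …, n` (one-based), that is, for all zero-based
`k = 1, …, n - 1`. -/
def condEvent (b : ℕ) (θ : ℝ) (n : ℕ) : Set (ℕ → I) :=
  {y | ∀ k : ℕ, 1 ≤ k → k < n → 1 ≤ Q b θ n k y}

/-- The i.i.d. law conditioned on `Q_{n,ℓ} ≥ 1` for all `ℓ = 2, …, n`. -/
noncomputable def condLaw (b : ℕ) (ρ : Measure I) [IsProbabilityMeasure ρ] (θ : ℝ) (n : ℕ) :
    Measure (ℕ → I) :=
  (iidLaw ρ)[|condEvent b θ n]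

/-- `P` is the limit law: a probability measure on `[0,1]^ℕ` such that, for every `θ ≥ 1`, the
conditioned laws converge to `P` on every event that depends on finitely many coordinates. -/
def IsLimitLaw (b : ℕ) (ρ : Measure I) [IsProbabilityMeasure ρ] (P : Measure (ℕ → I)) : Prop :=
  IsProbabilityMeasure P ∧
    ∀ θ : ℝ, 1 ≤ θ → ∀ A ∈ measurableCylinders (fun _ : ℕ => I),
      Tendsto (fun n : ℕ => condLaw b ρ θ n A) atTop (𝓝 (P A))

/-- `∑_{k ≥ 1} Y_k / b ^ (k-1)`, in the zero-based numbering. -/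
noncomputable def Qinf (b : ℕ) (y : ℕ → I) : ℝ :=
  ∑' k : ℕ, (y k : ℝ) / (b : ℝ) ^ k

end Avalanche

namespace Avalanche

/-! ### The quantities `Q` and the conditioning events -/

/-! Read backwards from `Q_{n,n} = θ`, the quantities `Q_{n,k}` form a Markov chain `x ↦ z + x / b`
with `z` of law `ρ`, and the conditioning says that this chain is not killed by falling below 1
before the first coordinate is used. Hence, for `A` depending on few coordinates, the probability of
`A` with survival and the probability of survival solve the same linear recursion in `n`
(`surv_succ`), and the conditional probability of `A` is their ratio `condProb`.

Convergence of this ratio, to a limit independent of `θ`, rests on three facts. Chains driven by the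
same variables approach each other by a factor `b` per step, and the upper one survives whenever the
lower one does. The bounded density gives a Harnack inequality for survival probabilities
(`exists_survProb_le_exp_mul`). Together these transfer lower bounds of the ratio from any point to
any higher one (`condProb_lower_bound`); applied to `A` and to its complement, this contracts the
oscillation of the ratio on `[1, Θ]` by a fixed factor (`condProb_contraction`).

The limits on cylinders come from a measure by weak compactness, the i.i.d. law dominating uniformly
in `n` (`exists_isLimitLaw`). For the fixed point, `condEvent` at time `n + 1` constrains only the
shifted sequence: the first coordinate stays independent with law `ρ`, and the shift has the
time-`n` law conditioned further on `Q_{n,0} ≥ 1`. In the limit these become `IsLimitLaw.map_cons`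
and `IsLimitLaw.map_shift`, and `Qinf_cons` turns them into the identity for `Qinf`. -/

lemma measurable_Q (b : ℕ) (θ : ℝ) (n k : ℕ) : Measurable (Q b θ n k) := by
  unfold Q
  fun_prop

lemma measurableSet_condEvent (b : ℕ) (θ : ℝ) (n : ℕ) : MeasurableSet (condEvent b θ n) := by
  have : condEvent b θ n = ⋂ k : ℕ, ⋂ (_ : 1 ≤ k), ⋂ (_ : k < n), {y | 1 ≤ Q b θ n k y} := by
    ext y; simp [condEvent]
  rw [this]
  exact MeasurableSet.iInter fun k => MeasurableSet.iInter fun _ => MeasurableSet.iInter fun _ =>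
    measurableSet_le measurable_const (measurable_Q b θ n k)

/-- The last variable is absorbed into the boundary value: one move of the backward chain. -/
lemma Q_succ (b : ℕ) (θ : ℝ) {n k : ℕ} (hk : k ≤ n) (y : ℕ → I) :
    Q b θ (n + 1) k y = Q b (y n + θ / b) n k y := by
  unfold Q
  rw [Nat.sub_add_comm hk, Finset.sum_range_succ, Nat.add_sub_cancel' hk, add_div, div_div,
    add_assoc, pow_succ']

lemma Q_self (b : ℕ) (θ : ℝ) (n : ℕ) (y : ℕ → I) : Q b θ n n y = θ := by
  simp [Q]

lemma Q_mono (b : ℕ) {θ θ' : ℝ} (h : θ ≤ θ') (n k : ℕ) (y : ℕ → I) :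
    Q b θ n k y ≤ Q b θ' n k y := by
  unfold Q; gcongr

lemma Q_congr (b : ℕ) (θ : ℝ) {n k : ℕ} {y y' : ℕ → I} (h : ∀ i < n, y i = y' i) :
    Q b θ n k y = Q b θ n k y' := by
  unfold Q
  congr 1
  refine Finset.sum_congr rfl fun i hi => ?_
  rw [Finset.mem_range] at hi
  rw [h (k + i) (by omega)]

lemma condEvent_mono (b : ℕ) {θ θ' : ℝ} (h : θ ≤ θ') (n : ℕ) :
    condEvent b θ n ⊆ condEvent b θ' n :=
  fun _ hy k h1 h2 => (hy k h1 h2).trans (Q_mono b h n k _)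

lemma condEvent_one (b : ℕ) (θ : ℝ) : condEvent b θ 1 = Set.univ := by
  ext y
  simp only [condEvent, Set.mem_ofPred_eq, Set.mem_univ, iff_true]
  intro k h1 h2; omega

lemma condEvent_congr (b : ℕ) (θ : ℝ) {n : ℕ} {y y' : ℕ → I} (h : ∀ i < n, y i = y' i) :
    y ∈ condEvent b θ n ↔ y' ∈ condEvent b θ n := by
  simp only [condEvent, Set.mem_ofPred_eq, Q_congr b θ h]

lemma mem_condEvent_succ (b : ℕ) (θ : ℝ) {n : ℕ} (hn : 1 ≤ n) (y : ℕ → I) :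
    y ∈ condEvent b θ (n + 1) ↔
      1 ≤ (y n : ℝ) + θ / b ∧ y ∈ condEvent b ((y n : ℝ) + θ / b) n := by
  simp only [condEvent, Set.mem_ofPred_eq]
  constructor
  · intro h
    refine ⟨?_, fun k h1 h2 => ?_⟩
    · have := h n hn (Nat.lt_succ_self n)
      rwa [Q_succ b θ le_rfl, Q_self] at this
    · have := h k h1 (by omega)
      rwa [Q_succ b θ h2.le] at this
  · rintro ⟨h0, h⟩ k h1 h2
    rw [Q_succ b θ (by omega)]
    rcases (Nat.lt_succ_iff.1 h2).lt_or_eq with h3 | rfl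
    · exact h k h1 h3
    · rwa [Q_self]

/-! ### Resampling and prepending a coordinate -/

instance (ρ : Measure I) [IsProbabilityMeasure ρ] : IsProbabilityMeasure (iidLaw ρ) := by
  unfold iidLaw; infer_instance

/-- The sequence `z, y 0, y 1, …`. -/
def cons (z : I) (y : ℕ → I) : ℕ → I
  | 0 => z
  | n + 1 => y n

/-- The sequence `y 1, y 2, …`. -/
def shift (y : ℕ → I) : ℕ → I := fun n => y (n + 1)

lemma cons_shift (y : ℕ → I) : cons (y 0) (shift y) = y := by
  funext n; cases n <;> rfl

lemma measurable_shift : Measurable shift :=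
  measurable_pi_lambda _ fun n => measurable_pi_apply (n + 1)

lemma measurable_cons : Measurable (fun p : I × (ℕ → I) => cons p.1 p.2) := by
  refine measurable_pi_lambda _ fun n => ?_
  cases n with
  | zero => exact measurable_fst
  | succ n => exact (measurable_pi_apply n).comp measurable_snd

lemma measurable_update_pair (n : ℕ) :
    Measurable (fun p : (ℕ → I) × I => Function.update p.1 n p.2) := by
  refine measurable_pi_lambda _ fun k => ?_
  by_cases h : k = n
  · subst h; simpa using measurable_snd
  · simp only [Function.update_of_ne h]
    exact (measurable_pi_apply k).comp measurable_fst

/-- Resampling coordinate `n` makes it an explicit independent variable, so that it can be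
integrated separately in `surv_succ`. -/
lemma map_update_iidLaw (ρ : Measure I) [IsProbabilityMeasure ρ] (n : ℕ) :
    ((iidLaw ρ).prod ρ).map (fun p : (ℕ → I) × I => Function.update p.1 n p.2) = iidLaw ρ := by
  refine Measure.eq_infinitePi _ fun s t ht => ?_
  rw [Measure.map_apply (measurable_update_pair n)
    (MeasurableSet.pi s.countable_toSet fun i _ => ht i)]
  by_cases hn : n ∈ s
  · have : (fun p : (ℕ → I) × I => Function.update p.1 n p.2) ⁻¹' (Set.pi s t)
        = (Set.pi (s.erase n : Finset ℕ) t) ×ˢ t n := by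
      ext ⟨y, z⟩
      simp only [Set.mem_preimage, Set.mem_pi, Finset.mem_coe, Set.mem_prod, Finset.mem_erase]
      constructor
      · intro h
        refine ⟨fun i hi => ?_, by simpa using h n hn⟩
        simpa [hi.1] using h i hi.2
      · rintro ⟨h1, h2⟩ i hi
        by_cases hin : i = n
        · subst hin; simpa using h2
        · simpa [hin] using h1 i ⟨hin, hi⟩
    rw [this, Measure.prod_prod, iidLaw, Measure.infinitePi_pi _ (fun i _ => ht i),
      Finset.prod_erase_mul _ _ hn]
  · have : (fun p : (ℕ → I) × I => Function.update p.1 n p.2) ⁻¹' (Set.pi s t)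
        = (Set.pi s t) ×ˢ Set.univ := by
      ext ⟨y, z⟩
      simp only [Set.mem_preimage, Set.mem_pi, Finset.mem_coe, Set.mem_prod, Set.mem_univ, and_true]
      refine forall₂_congr fun i hi => ?_
      have : i ≠ n := fun h => hn (h ▸ hi)
      simp [this]
    rw [this, Measure.prod_prod, iidLaw, Measure.infinitePi_pi _ (fun i _ => ht i), measure_univ,
      mul_one]

lemma map_cons_iidLaw (ρ : Measure I) [IsProbabilityMeasure ρ] :
    (ρ.prod (iidLaw ρ)).map (fun p : I × (ℕ → I) => cons p.1 p.2) = iidLaw ρ := by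
  classical
  refine Measure.eq_infinitePi _ fun s t ht => ?_
  rw [Measure.map_apply measurable_cons (MeasurableSet.pi s.countable_toSet fun i _ => ht i)]
  -- Padding with `univ` off `s` replaces the finite set by an initial segment, where the coordinate
  -- 0 splits off.
  set t' : ℕ → Set I := fun i => if i ∈ s then t i else Set.univ with ht'
  obtain ⟨N, hN⟩ : ∃ N, s ⊆ Finset.range (N + 1) :=
    ⟨s.sup id, fun i hi => Finset.mem_range.2 (Nat.lt_succ_of_le (Finset.le_sup (f := id) hi))⟩
  have hm : ∀ i, MeasurableSet (t' i) := fun i => by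
    simp only [ht']; split_ifs
    exacts [ht i, MeasurableSet.univ]
  have h1 : (fun p : I × (ℕ → I) => cons p.1 p.2) ⁻¹' (Set.pi s t)
      = t' 0 ×ˢ (Set.pi (Finset.range N : Finset ℕ) fun i => t' (i + 1)) := by
    ext ⟨z, y⟩
    simp only [Set.mem_preimage, Set.mem_pi, Finset.mem_coe, Set.mem_prod, Finset.mem_range]
    constructor
    · intro h
      refine ⟨?_, fun i _ => ?_⟩
      · simp only [ht']; split_ifs with h0
        exacts [h 0 h0, trivial]
      · simp only [ht']; split_ifs with h0
        exacts [h (i + 1) h0, trivial]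
    · rintro ⟨h0, h⟩ i hi
      cases i with
      | zero => simpa [ht', hi, cons] using h0
      | succ i =>
        have := Finset.mem_range.1 (hN hi)
        simpa [ht', hi, cons] using h i (by omega)
  have h2 : ∏ i ∈ s, ρ (t i) = ∏ i ∈ Finset.range (N + 1), ρ (t' i) := by
    rw [← Finset.prod_subset hN]
    · exact Finset.prod_congr rfl fun i hi => by simp [ht', hi]
    · intro i _ hi; simp [ht', hi]
  rw [h1, Measure.prod_prod, iidLaw, Measure.infinitePi_pi _ (fun i _ => hm (i + 1)), h2,
    Finset.prod_range_succ', mul_comm]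

/-! ### Survival probabilities -/

/-- The set `A` depends only on the coordinates below `m`. -/
def DependsBelow (m : ℕ) (A : Set (ℕ → I)) : Prop :=
  ∀ y y' : ℕ → I, (∀ i < m, y i = y' i) → (y ∈ A ↔ y' ∈ A)

/-- The probability of `A` together with the conditioning event, as a function of the
boundary value. -/
noncomputable def surv (b : ℕ) (ρ : Measure I) [IsProbabilityMeasure ρ] (A : Set (ℕ → I)) (n : ℕ)
    (x : ℝ) : ℝ :=
  (iidLaw ρ).real (A ∩ condEvent b x n)

section surv

variable (b : ℕ) (ρ : Measure I) [IsProbabilityMeasure ρ] {A : Set (ℕ → I)}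

lemma surv_nonneg (A : Set (ℕ → I)) (n : ℕ) (x : ℝ) : 0 ≤ surv b ρ A n x := measureReal_nonneg

lemma surv_le_one (A : Set (ℕ → I)) (n : ℕ) (x : ℝ) : surv b ρ A n x ≤ 1 := measureReal_le_one

lemma surv_mono (A : Set (ℕ → I)) (n : ℕ) : Monotone (surv b ρ A n) := fun _ _ h =>
  measureReal_mono (Set.inter_subset_inter_right _ (condEvent_mono b h n))

lemma surv_le_univ (A : Set (ℕ → I)) (n : ℕ) (x : ℝ) : surv b ρ A n x ≤ surv b ρ Set.univ n x :=
  measureReal_mono (Set.inter_subset_inter_left _ (Set.subset_univ _))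

lemma surv_add_compl (hA : MeasurableSet A) (n : ℕ) (x : ℝ) :
    surv b ρ A n x + surv b ρ Aᶜ n x = surv b ρ Set.univ n x := by
  unfold surv
  rw [Set.univ_inter, Set.inter_comm, Set.inter_comm Aᶜ, ← Set.sdiff_eq]
  exact measureReal_inter_add_sdiff hA

/-- One step of the killed chain, acting on functions. -/
noncomputable def step (u : ℝ → ℝ) (x : ℝ) : ℝ :=
  ∫ z : I, (if 1 ≤ (z : ℝ) + x / b then u ((z : ℝ) + x / b) else 0) ∂ρ

/-- Coordinate `n` enters only through the new boundary value `z + x / b`: the event `A` does not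
see it because `m ≤ n`. The condition `1 ≤ n` ensures that the new value is itself tested against 1.
-/
lemma surv_succ {m n : ℕ} (hA : MeasurableSet A) (hAm : DependsBelow m A) (hmn : m ≤ n)
    (hn : 1 ≤ n) (x : ℝ) :
    surv b ρ A (n + 1) x = step b ρ (surv b ρ A n) x := by
  have hE : MeasurableSet (A ∩ condEvent b x (n + 1)) := hA.inter (measurableSet_condEvent _ _ _)
  have key : ∀ z : I, (fun y : ℕ → I => (y, z)) ⁻¹'
      ((fun p : (ℕ → I) × I => Function.update p.1 n p.2) ⁻¹' (A ∩ condEvent b x (n + 1)))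
      = if 1 ≤ (z : ℝ) + x / b then A ∩ condEvent b ((z : ℝ) + x / b) n else ∅ := by
    intro z
    ext y
    have hu : ∀ i < n, Function.update y n z i = y i := fun i hi => by
      simp [hi.ne]
    simp only [Set.mem_preimage, Set.mem_inter_iff, mem_condEvent_succ b x hn,
      Function.update_self, condEvent_congr b _ hu,
      hAm _ _ (fun i hi => hu i (hi.trans_le hmn))]
    split_ifs with h <;> simp [h]
  have h1 : (iidLaw ρ) (A ∩ condEvent b x (n + 1))
      = ∫⁻ z : I, (iidLaw ρ) (if 1 ≤ (z : ℝ) + x / b then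
          A ∩ condEvent b ((z : ℝ) + x / b) n else ∅) ∂ρ := by
    conv_lhs => rw [← map_update_iidLaw ρ n]
    rw [Measure.map_apply (measurable_update_pair n) hE,
      Measure.prod_apply_symm (measurable_update_pair n hE)]
    simp_rw [key]
  have hmeas : Measurable fun z : I => (iidLaw ρ) (if 1 ≤ (z : ℝ) + x / b then
          A ∩ condEvent b ((z : ℝ) + x / b) n else ∅) := by
    simp_rw [← key]
    exact measurable_measure_prodMk_right (measurable_update_pair n hE)
  rw [surv, measureReal_def, h1, ← integral_toReal hmeas.aemeasurable
    (Eventually.of_forall fun _ => measure_lt_top _ _), step]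
  refine integral_congr_ae (Eventually.of_forall fun z => ?_)
  simp only []
  split_ifs <;> simp [surv, measureReal_def]

end surv

/-! ### Bounded densities -/

lemma exists_real_Ico_le {b : ℕ} {ρ : Measure I} [IsProbabilityMeasure ρ] (hρ : MFlat b ρ) :
    ∃ D : ℝ, 0 ≤ D ∧ ∀ u v : ℝ, u ≤ v → ρ.real {z : I | u ≤ (z : ℝ) ∧ (z : ℝ) < v} ≤ D * (v - u) := by
  refine ⟨(essSup (ρ.rnDeriv volume) volume).toReal, ENNReal.toReal_nonneg, fun u v huv => ?_⟩
  have hvol : (volume : Measure I) {z : I | u ≤ (z : ℝ) ∧ (z : ℝ) < v} ≤ ENNReal.ofReal (v - u) := by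
    rw [← Real.volume_Ico, unitInterval.volume_apply]
    refine measure_mono ?_
    rintro _ ⟨z, hz, rfl⟩
    exact hz
  have h : ρ {z : I | u ≤ (z : ℝ) ∧ (z : ℝ) < v}
      ≤ essSup (ρ.rnDeriv volume) volume * ENNReal.ofReal (v - u) := by
    rw [← Measure.setLIntegral_rnDeriv hρ.absolutelyContinuous]
    calc ∫⁻ z in {z : I | u ≤ (z : ℝ) ∧ (z : ℝ) < v}, ρ.rnDeriv volume z
        ≤ ∫⁻ z in {z : I | u ≤ (z : ℝ) ∧ (z : ℝ) < v}, essSup (ρ.rnDeriv volume) volume :=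
          lintegral_mono_ae (ae_restrict_of_ae (ENNReal.ae_le_essSup _))
      _ ≤ _ := by
          rw [setLIntegral_const]
          gcongr
  calc ρ.real {z : I | u ≤ (z : ℝ) ∧ (z : ℝ) < v}
      ≤ (essSup (ρ.rnDeriv volume) volume * ENNReal.ofReal (v - u)).toReal :=
        ENNReal.toReal_mono (ENNReal.mul_ne_top hρ.density_bounded.ne ENNReal.ofReal_ne_top) h
    _ = _ := by rw [ENNReal.toReal_mul, ENNReal.toReal_ofReal (sub_nonneg.2 huv)]

lemma MFlat.measure_coe_eq_zero {b : ℕ} {ρ : Measure I} [IsProbabilityMeasure ρ] (hρ : MFlat b ρ)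
    (c : ℝ) : ρ {z : I | (z : ℝ) = c} = 0 := by
  refine hρ.absolutelyContinuous ?_
  refine Set.Subsingleton.measure_zero (fun x hx y hy => Subtype.ext ?_) _
  rw [Set.mem_ofPred_eq] at hx hy
  rw [hx, hy]

/-! ### Elementary properties of the step operator -/

section step

variable {b : ℕ} {ρ : Measure I} [IsProbabilityMeasure ρ]

lemma measurable_step_integrand {u : ℝ → ℝ} (hu : Measurable u) (x : ℝ) :
    Measurable fun z : I => if 1 ≤ (z : ℝ) + x / b then u ((z : ℝ) + x / b) else 0 := by
  refine Measurable.ite (measurableSet_le measurable_const (by fun_prop)) ?_ measurable_const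
  exact hu.comp (by fun_prop)

lemma integrable_step_integrand {u : ℝ → ℝ} (hu : Measurable u) {c : ℝ} (hc : ∀ x, |u x| ≤ c)
    (x : ℝ) :
    Integrable (fun z : I => if 1 ≤ (z : ℝ) + x / b then u ((z : ℝ) + x / b) else 0) ρ := by
  refine Integrable.of_bound (measurable_step_integrand hu x).aestronglyMeasurable c
    (Eventually.of_forall fun z => ?_)
  split_ifs
  · exact hc _
  · simpa using (abs_nonneg _).trans (hc 0)

lemma step_add_mul {u v : ℝ → ℝ} (hu : Measurable u) {c : ℝ} (hc : ∀ x, |u x| ≤ c)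
    (hv : Measurable v) {d : ℝ} (hd : ∀ x, |v x| ≤ d) (α β x : ℝ) :
    step b ρ (fun x => α * u x + β * v x) x = α * step b ρ u x + β * step b ρ v x := by
  unfold step
  rw [← integral_const_mul, ← integral_const_mul, ← integral_add
    ((integrable_step_integrand hu hc x).const_mul α)
    ((integrable_step_integrand hv hd x).const_mul β)]
  refine integral_congr_ae (Eventually.of_forall fun z => ?_)
  simp only []
  split_ifs <;> simp

/-- The interval `[1, Θ]` is stable under the moves of the chain, for `Θ ≥ 2`. -/
lemma move_le (hb : 2 ≤ b) {Θ x : ℝ} (hΘ : 2 ≤ Θ) (hxΘ : x ≤ Θ) (z : I) :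
    (z : ℝ) + x / b ≤ Θ := by
  have hb' : (2 : ℝ) ≤ b := by exact_mod_cast hb
  have h1 : x / b ≤ Θ / 2 := by gcongr
  linarith [z.2.2]

/-- A comparison principle at two ordered, close points, for the step operator. -/
lemma step_le_step (hb : 2 ≤ b) {u v : ℝ → ℝ} (hu : Measurable u) {c : ℝ} (hc : ∀ x, |u x| ≤ c)
    (hv : Measurable v) {d : ℝ} (hd : ∀ x, |v x| ≤ d) {Θ ε : ℝ} (hΘ : 2 ≤ Θ)
    (hu0 : ∀ x, 1 ≤ x → x ≤ Θ → 0 ≤ u x)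
    (h : ∀ x x', 1 ≤ x → x ≤ x' → x' ≤ Θ → x' - x ≤ ε → v x ≤ u x')
    {x x' : ℝ} (hxx' : x ≤ x') (hx' : x' ≤ Θ) (hε : x' - x ≤ b * ε) :
    step b ρ v x ≤ step b ρ u x' := by
  have hb' : (0 : ℝ) < b := by positivity
  refine integral_mono (integrable_step_integrand hv hd x) (integrable_step_integrand hu hc x')
    fun z => ?_
  have hle : x / b ≤ x' / b := by gcongr
  have hz := move_le hb hΘ hx' z
  simp only []
  -- Survival from `x` forces survival from `x'`. When only `x'` survives, nonnegativity of `u`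
  -- suffices.
  split_ifs with h1 h2 h2
  · refine h _ _ h1 (by linarith) hz ?_
    rw [add_sub_add_left_eq_sub, ← sub_div, div_le_iff₀ hb']
    linarith
  · linarith
  · exact hu0 _ h2 hz
  · exact le_rfl

lemma step_nonneg {ρ : Measure I} (hb : 2 ≤ b) {u : ℝ → ℝ} {Θ : ℝ} (hΘ : 2 ≤ Θ)
    (hu0 : ∀ x, 1 ≤ x → x ≤ Θ → 0 ≤ u x) {x : ℝ} (hxΘ : x ≤ Θ) :
    0 ≤ step b ρ u x := by
  refine integral_nonneg fun z => ?_
  simp only [Pi.zero_apply]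
  split_ifs with h
  · exact hu0 _ h (move_le hb hΘ hxΘ z)
  · exact le_rfl

end step

/-! ### A Harnack inequality for survival probabilities -/

section harnack

variable {b : ℕ} {ρ : Measure I} [IsProbabilityMeasure ρ]

lemma measurable_surv (A : Set (ℕ → I)) (n : ℕ) : Measurable (surv b ρ A n) :=
  (surv_mono b ρ A n).measurable

lemma abs_surv_le (A : Set (ℕ → I)) (n : ℕ) (x : ℝ) : |surv b ρ A n x| ≤ 1 := by
  rw [abs_of_nonneg (surv_nonneg b ρ A n x)]; exact surv_le_one b ρ A n x

/-- The survival probability. -/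
noncomputable abbrev survProb (b : ℕ) (ρ : Measure I) [IsProbabilityMeasure ρ] (n : ℕ) (x : ℝ) : ℝ :=
  surv b ρ Set.univ n x

/-- The mass of `[1 - 1/b, 1]`, which bounds one-step survival probabilities from below. -/
noncomputable def topMass (b : ℕ) (ρ : Measure I) : ℝ :=
  ρ.real {x : I | 1 - 1 / (b : ℝ) ≤ (x : ℝ)}

lemma topMass_pos (hρ : MFlat b ρ) : 0 < topMass b ρ :=
  ENNReal.toReal_pos hρ.mass_pos.ne' (measure_ne_top _ _)

lemma survProb_one (x : ℝ) : survProb b ρ 1 x = 1 := by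
  simp [survProb, surv, condEvent_one]

lemma survProb_succ {n : ℕ} (hn : 1 ≤ n) (x : ℝ) :
    survProb b ρ (n + 1) x = step b ρ (survProb b ρ n) x :=
  surv_succ b ρ MeasurableSet.univ (m := 0) (fun _ _ _ => by simp) (Nat.zero_le _) hn x

/-- From any `x ≥ 1`, a variable in `[1 - 1/b, 1]` keeps the chain at or above 1, and survival is
monotone in the starting point. -/
lemma topMass_mul_survProb_le {n : ℕ} (hn : 1 ≤ n) {x : ℝ} (hx : 1 ≤ x) :
    topMass b ρ * survProb b ρ n 1 ≤ survProb b ρ (n + 1) x := by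
  have hm : MeasurableSet {z : I | 1 - 1 / (b : ℝ) ≤ (z : ℝ)} :=
    measurableSet_le measurable_const measurable_subtype_coe
  have h0 : topMass b ρ * survProb b ρ n 1 =
      ∫ z : I, ({z : I | 1 - 1 / (b : ℝ) ≤ (z : ℝ)}).indicator (fun _ => survProb b ρ n 1) z ∂ρ := by
    rw [integral_indicator_const _ hm, smul_eq_mul, topMass]
  rw [survProb_succ hn, h0]
  refine integral_mono ((integrable_const _).indicator hm)
    (integrable_step_integrand (measurable_surv _ n) (abs_surv_le _ n) x) fun z => ?_
  have hle : (1 : ℝ) / b ≤ x / b := by gcongr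
  simp only [Set.indicator_apply, Set.mem_ofPred_eq]
  split_ifs with h1 h2 h2
  · exact surv_mono b ρ _ n h2
  · linarith
  · exact surv_nonneg b ρ _ n _
  · exact le_rfl

lemma topMass_pow_le_survProb (n : ℕ) {x : ℝ} (hx : 1 ≤ x) :
    topMass b ρ ^ n ≤ survProb b ρ (n + 1) x := by
  have hp : 0 ≤ topMass b ρ := measureReal_nonneg
  induction n generalizing x with
  | zero => simp [survProb_one]
  | succ n ih =>
    calc topMass b ρ ^ (n + 1) = topMass b ρ * topMass b ρ ^ n := pow_succ' _ _
      _ ≤ topMass b ρ * survProb b ρ (n + 1) 1 := by gcongr; exact ih le_rfl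
      _ ≤ _ := topMass_mul_survProb_le (by omega) hx

lemma survProb_pos (hρ : MFlat b ρ) {n : ℕ} (hn : 1 ≤ n) {x : ℝ} (hx : 1 ≤ x) :
    0 < survProb b ρ n x := by
  obtain ⟨n, rfl⟩ : ∃ m, n = m + 1 := ⟨n - 1, by omega⟩
  exact (pow_pos (topMass_pos hρ) n).trans_le (topMass_pow_le_survProb n hx)

/-- Induction on `n`: after one step the distance is `δ = (x' - x) / b`. Common survival costs `exp
(a * δ)`. Survival from `x'` alone has probability at most `D * δ`, and `topMass` compares its
contribution with survival from `x`; with `a = D / p` this costs another factor `1 + a * δ ≤ exp (a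
* δ)`. Since `b ≥ 2`, the total `2 * δ` is at most `x' - x`. -/
lemma exists_survProb_le_exp_mul (hb : 2 ≤ b) (hρ : MFlat b ρ) :
    ∃ a : ℝ, 0 ≤ a ∧ ∀ n, 1 ≤ n → ∀ x x' : ℝ, 1 ≤ x → x ≤ x' →
      survProb b ρ n x' ≤ Real.exp (a * (x' - x)) * survProb b ρ n x := by
  obtain ⟨D, hD0, hD⟩ := exists_real_Ico_le hρ
  have hp := topMass_pos hρ
  have hb' : (2 : ℝ) ≤ b := by exact_mod_cast hb
  refine ⟨D / topMass b ρ, by positivity, fun n hn => ?_⟩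
  set p := topMass b ρ with hpdef
  set a := D / p with ha
  have ha0 : 0 ≤ a := by positivity
  induction n, hn using Nat.le_induction with
  | base =>
    intro x x' hx hxx'
    rw [survProb_one, survProb_one, mul_one]
    exact Real.one_le_exp (mul_nonneg ha0 (sub_nonneg.2 hxx'))
  | succ n hn ih =>
    intro x x' hx hxx'
    set δ := (x' - x) / b with hδ
    have hδ0 : 0 ≤ δ := div_nonneg (sub_nonneg.2 hxx') (by positivity)
    have hδx : x' / b = x / b + δ := by rw [hδ]; ring
    set W : Set I := {z : I | 1 - x' / b ≤ (z : ℝ) ∧ (z : ℝ) < 1 - x / b} with hW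
    have hWm : MeasurableSet W := (measurableSet_le measurable_const measurable_subtype_coe).inter
      (measurableSet_lt measurable_subtype_coe measurable_const)
    have hWr : ρ.real W ≤ D * δ := by
      have := hD (1 - x' / b) (1 - x / b) (by linarith)
      rwa [show 1 - x / b - (1 - x' / b) = δ by linarith] at this
    have hint : Integrable (W.indicator fun _ => survProb b ρ n 1) ρ :=
      (integrable_const _).indicator hWm
    have hintx := integrable_step_integrand (b := b) (ρ := ρ) (measurable_surv (b := b) (ρ := ρ)
      Set.univ n) (abs_surv_le _ n) x
    have h1 : survProb b ρ (n + 1) x' ≤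
        Real.exp (a * δ) * (survProb b ρ (n + 1) x + ρ.real W * survProb b ρ n 1) := by
      rw [survProb_succ hn, survProb_succ hn, ← smul_eq_mul (ρ.real W),
        ← integral_indicator_const _ hWm, step, step, ← integral_add hintx hint,
        ← integral_const_mul]
      refine integral_mono (integrable_step_integrand (measurable_surv _ n) (abs_surv_le _ n) x')
        ((hintx.add hint).const_mul _) fun z => ?_
      simp only [Set.indicator_apply, hW, Set.mem_ofPred_eq]
      have hexp := Real.exp_pos (a * δ)
      -- If only `x'` survives, then `z ∈ W` and the new value lies within `δ` of 1, so the
      -- induction hypothesis is used from the point 1. The mixed cases left are contradictory.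
      split_ifs with g1 g2 g3 g4 g5 g6 g7
      · linarith [g3.2]
      · have := ih _ ((z : ℝ) + x' / b) g2 (by linarith)
        rw [show (z : ℝ) + x' / b - (z + x / b) = δ by linarith] at this
        rwa [add_zero]
      · have := ih 1 ((z : ℝ) + x' / b) le_rfl (by linarith)
        rw [zero_add]
        refine this.trans (mul_le_mul_of_nonneg_right ?_ (surv_nonneg _ _ _ _ _))
        gcongr
        linarith
      · exact absurd ⟨by linarith, by linarith⟩ g4
      · linarith
      · linarith
      · exact absurd g7.1 (by linarith)
      · simp
    have h2 : ρ.real W * survProb b ρ n 1 ≤ a * δ * survProb b ρ (n + 1) x := by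
      have := topMass_mul_survProb_le (b := b) (ρ := ρ) hn hx
      calc ρ.real W * survProb b ρ n 1 ≤ D * δ * survProb b ρ n 1 :=
            mul_le_mul_of_nonneg_right hWr (surv_nonneg _ _ _ _ _)
        _ = a * δ * (p * survProb b ρ n 1) := by rw [ha]; field_simp
        _ ≤ _ := by gcongr
    have h3 : a * δ + 1 ≤ Real.exp (a * δ) := Real.add_one_le_exp _
    have hS := surv_nonneg b ρ Set.univ (n + 1) x
    calc survProb b ρ (n + 1) x' ≤ _ := h1
      _ ≤ Real.exp (a * δ) * (Real.exp (a * δ) * survProb b ρ (n + 1) x) := by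
          gcongr
          nlinarith
      _ = Real.exp (a * (2 * δ)) * survProb b ρ (n + 1) x := by
          rw [← mul_assoc, ← Real.exp_add]; ring_nf
      _ ≤ _ := by
          gcongr
          rw [hδ, mul_div_assoc', div_le_iff₀ (by positivity)]
          nlinarith [sub_nonneg.2 hxx']

end harnack

/-! ### Convergence of conditional probabilities -/

section convergence

variable {b : ℕ} {ρ : Measure I} [IsProbabilityMeasure ρ] {A : Set (ℕ → I)} {m : ℕ}

/-- Iterated form of the comparison principle. -/
lemma iterate_step_le (hb : 2 ≤ b) {u v : ℕ → ℝ → ℝ} (hu : ∀ k, Measurable (u k)) {c : ℝ}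
    (hc : ∀ k x, |u k x| ≤ c) (hv : ∀ k, Measurable (v k)) {d : ℝ} (hd : ∀ k x, |v k x| ≤ d)
    (hus : ∀ k x, u (k + 1) x = step b ρ (u k) x) (hvs : ∀ k x, v (k + 1) x = step b ρ (v k) x)
    {Θ ε : ℝ} (hΘ : 2 ≤ Θ) (hu0 : ∀ x, 1 ≤ x → x ≤ Θ → 0 ≤ u 0 x)
    (h : ∀ x x', 1 ≤ x → x ≤ x' → x' ≤ Θ → x' - x ≤ ε → v 0 x ≤ u 0 x') (k : ℕ) :
    (∀ x, 1 ≤ x → x ≤ Θ → 0 ≤ u k x) ∧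
      ∀ x x', 1 ≤ x → x ≤ x' → x' ≤ Θ → x' - x ≤ b ^ k * ε → v k x ≤ u k x' := by
  induction k with
  | zero => exact ⟨hu0, by simpa using h⟩
  | succ k ih =>
    refine ⟨fun x _ hxΘ => ?_, fun x x' _ hxx' hx' hε => ?_⟩
    · rw [hus]; exact step_nonneg hb hΘ ih.1 hxΘ
    · rw [hus, hvs]
      refine step_le_step hb (hu k) (hc k) (hv k) (hd k) hΘ ih.1 ih.2 hxx' hx' ?_
      rwa [← mul_assoc, ← pow_succ']

lemma surv_combination_succ (hA : MeasurableSet A) (hAm : DependsBelow m A) {n : ℕ} (hmn : m ≤ n)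
    (hn : 1 ≤ n) (β x : ℝ) :
    surv b ρ A (n + 1) x - β * survProb b ρ (n + 1) x =
      step b ρ (fun x => surv b ρ A n x - β * survProb b ρ n x) x := by
  have := step_add_mul (b := b) (ρ := ρ) (measurable_surv (b := b) (ρ := ρ) A n) (abs_surv_le A n)
    (measurable_surv (b := b) (ρ := ρ) Set.univ n) (abs_surv_le Set.univ n) 1 (-β) x
  simp only [one_mul, neg_mul, ← sub_eq_add_neg] at this
  rw [this, surv_succ b ρ hA hAm hmn hn, survProb_succ hn]

lemma abs_surv_combination_le (A : Set (ℕ → I)) (n : ℕ) (β x : ℝ) :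
    |surv b ρ A n x - β * survProb b ρ n x| ≤ 1 + |β| := by
  refine (abs_sub _ _).trans (add_le_add (abs_surv_le A n x) ?_)
  rw [abs_mul]
  exact mul_le_of_le_one_right (abs_nonneg _) (abs_surv_le _ n x)

/-- The conditional probability of `A` given the conditioning event. -/
noncomputable def condProb (b : ℕ) (ρ : Measure I) [IsProbabilityMeasure ρ] (A : Set (ℕ → I))
    (n : ℕ) (x : ℝ) : ℝ :=
  surv b ρ A n x / survProb b ρ n x

lemma condProb_nonneg (A : Set (ℕ → I)) (n : ℕ) (x : ℝ) : 0 ≤ condProb b ρ A n x :=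
  div_nonneg (surv_nonneg _ _ _ _ _) (surv_nonneg _ _ _ _ _)

lemma condProb_le_one (A : Set (ℕ → I)) (n : ℕ) (x : ℝ) : condProb b ρ A n x ≤ 1 :=
  div_le_one_of_le₀ (surv_le_univ _ _ _ _ _) (surv_nonneg _ _ _ _ _)

lemma condProb_compl (hρ : MFlat b ρ) (hA : MeasurableSet A) {n : ℕ} (hn : 1 ≤ n) {x : ℝ}
    (hx : 1 ≤ x) : condProb b ρ Aᶜ n x = 1 - condProb b ρ A n x := by
  have h := survProb_pos hρ hn hx
  rw [condProb, condProb, eq_sub_iff_add_eq, ← add_div, add_comm, surv_add_compl b ρ hA,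
    div_self h.ne']

/-- Lower bounds for conditional probabilities persist and, up to an error that vanishes with the
number of steps, propagate upwards from any point. -/
lemma condProb_lower_bound (hb : 2 ≤ b) (hρ : MFlat b ρ) {a : ℝ} (ha : 0 ≤ a)
    (hharnack : ∀ n, 1 ≤ n → ∀ x x' : ℝ, 1 ≤ x → x ≤ x' →
      survProb b ρ n x' ≤ Real.exp (a * (x' - x)) * survProb b ρ n x)
    (hA : MeasurableSet A) (hAm : DependsBelow m A) {n : ℕ} (hmn : m ≤ n) (hn : 1 ≤ n)
    {Θ c : ℝ} (hΘ : 2 ≤ Θ) (hc0 : 0 ≤ c) (hc1 : c ≤ 1)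
    (hc : ∀ x, 1 ≤ x → x ≤ Θ → c ≤ condProb b ρ A n x) (k : ℕ) :
    (∀ x, 1 ≤ x → x ≤ Θ → c ≤ condProb b ρ A (n + k) x) ∧
    ∀ x x', 1 ≤ x → x ≤ x' → x' ≤ Θ →
      c + Real.exp (-(a * Θ)) * (condProb b ρ A (n + k) x - c - (Real.exp (a * (Θ / b ^ k)) - 1))
        ≤ condProb b ρ A (n + k) x' := by
  have hb0 : (0 : ℝ) < b := by positivity
  -- With this `ε`, the closeness constraint after `k` steps reads `x' - x ≤ Θ`, which is automatic
  -- on `[1, Θ]`.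
  set ε := Θ / (b : ℝ) ^ k with hε
  have hε0 : 0 ≤ ε := by positivity
  set η := Real.exp (a * ε) - 1 with hη
  have hη0 : 0 ≤ η := sub_nonneg.2 (Real.one_le_exp (by positivity))
  obtain ⟨h1, h2⟩ := iterate_step_le (ρ := ρ) hb
    (u := fun k x => surv b ρ A (n + k) x - c * survProb b ρ (n + k) x)
    (v := fun k x => surv b ρ A (n + k) x - (c + η) * survProb b ρ (n + k) x)
    (fun k => (measurable_surv _ _).sub ((measurable_surv _ _).const_mul _))
    (fun k x => abs_surv_combination_le A _ _ _)
    (fun k => (measurable_surv _ _).sub ((measurable_surv _ _).const_mul _))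
    (fun k x => abs_surv_combination_le A _ _ _)
    (fun k x => surv_combination_succ (n := n + k) hA hAm (by omega) (by omega) _ _)
    (fun k x => surv_combination_succ (n := n + k) hA hAm (by omega) (by omega) _ _) (ε := ε) hΘ
    (fun x hx hxΘ => by
      have := hc x hx hxΘ
      rw [condProb, le_div_iff₀ (survProb_pos hρ hn hx)] at this
      simpa using this)
    -- For close points, Harnack gives a ratio of survival probabilities at most `1 + η`; the extra
    -- `η` in `v` pays for it because `c ≤ 1`.
    (fun x x' hx hxx' hx' hd => by
      have e1 := surv_mono b ρ A n hxx'
      have e2 := hharnack n hn x x' hx hxx'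
      have e3 : Real.exp (a * (x' - x)) ≤ 1 + η := by
        rw [hη, add_sub_cancel]; gcongr
      have e4 := survProb_pos hρ hn hx
      have e5 : survProb b ρ n x' ≤ (1 + η) * survProb b ρ n x :=
        e2.trans (mul_le_mul_of_nonneg_right e3 e4.le)
      have e6 : c * survProb b ρ n x' ≤ c * ((1 + η) * survProb b ρ n x) := by gcongr
      have e7 : c * (η * survProb b ρ n x) ≤ 1 * (η * survProb b ρ n x) := by gcongr
      simp only [add_zero]
      linarith) k
  have hlow : ∀ x, 1 ≤ x → x ≤ Θ → c ≤ condProb b ρ A (n + k) x := fun x hx hxΘ => by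
    rw [condProb, le_div_iff₀ (survProb_pos hρ (by omega) hx)]
    simpa using h1 x hx hxΘ
  refine ⟨hlow, fun x x' hx hxx' hx' => ?_⟩
  have hx1 : 1 ≤ x' := hx.trans hxx'
  have hd : x' - x ≤ b ^ k * ε := by
    rw [hε, mul_div_cancel₀ _ (by positivity)]; linarith
  have h3 := h2 x x' hx hxx' hx' hd
  have p1 := survProb_pos (n := n + k) hρ (by omega) hx
  have p2 := survProb_pos (n := n + k) hρ (by omega) hx1
  have q1 : surv b ρ A (n + k) x = condProb b ρ A (n + k) x * survProb b ρ (n + k) x := by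
    rw [condProb, div_mul_cancel₀ _ p1.ne']
  have q2 : surv b ρ A (n + k) x' = condProb b ρ A (n + k) x' * survProb b ρ (n + k) x' := by
    rw [condProb, div_mul_cancel₀ _ p2.ne']
  -- A nonpositive excess adds nothing to the bound `c`; a positive one is carried to `x'` by
  -- Harnack over a distance at most `Θ`.
  rcases le_total (condProb b ρ A (n + k) x - c - η) 0 with hs | hs
  · have := mul_nonpos_of_nonneg_of_nonpos (Real.exp_pos (-(a * Θ))).le hs
    linarith [hlow x' hx1 hx']
  · have e2 := hharnack (n + k) (by omega) x x' hx hxx'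
    have e3 : Real.exp (-(a * Θ)) * survProb b ρ (n + k) x' ≤ survProb b ρ (n + k) x := by
      calc Real.exp (-(a * Θ)) * survProb b ρ (n + k) x'
          ≤ Real.exp (-(a * Θ)) * (Real.exp (a * (x' - x)) * survProb b ρ (n + k) x) := by gcongr
        _ = Real.exp (-(a * Θ) + a * (x' - x)) * survProb b ρ (n + k) x := by
            rw [Real.exp_add, mul_assoc]
        _ ≤ 1 * survProb b ρ (n + k) x := by
            gcongr
            rw [Real.exp_le_one_iff]
            nlinarith
        _ = _ := one_mul _
    have e4 := mul_le_mul_of_nonneg_left e3 hs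
    simp only [q1, q2] at h3
    refine le_of_mul_le_mul_right ?_ p2
    linarith

lemma condProb_contraction (hb : 2 ≤ b) (hρ : MFlat b ρ) {a : ℝ} (ha : 0 ≤ a)
    (hharnack : ∀ n, 1 ≤ n → ∀ x x' : ℝ, 1 ≤ x → x ≤ x' →
      survProb b ρ n x' ≤ Real.exp (a * (x' - x)) * survProb b ρ n x)
    (hA : MeasurableSet A) (hAm : DependsBelow m A) {n : ℕ} (hmn : m ≤ n) (hn : 1 ≤ n)
    {Θ i s : ℝ} (hΘ : 2 ≤ Θ) (hi : 0 ≤ i) (hs : s ≤ 1)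
    (hc : ∀ x, 1 ≤ x → x ≤ Θ → condProb b ρ A n x ∈ Set.Icc i s) (k : ℕ) :
    (∀ x, 1 ≤ x → x ≤ Θ → condProb b ρ A (n + k) x ∈ Set.Icc i s) ∧
    ∃ i' s', 0 ≤ i' ∧ s' ≤ 1 ∧
      s' - i' ≤ (1 - Real.exp (-(a * Θ))) * (s - i) +
        Real.exp (-(a * Θ)) * (Real.exp (a * (Θ / b ^ k)) - 1) ∧
      ∀ x, 1 ≤ x → x ≤ Θ → condProb b ρ A (n + k) x ∈ Set.Icc i' s' := by
  have h1 : 1 ≤ (1 : ℝ) ∧ 1 ≤ Θ := ⟨le_rfl, by linarith⟩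
  have his : i ≤ s := (hc 1 h1.1 h1.2).1.trans (hc 1 h1.1 h1.2).2
  have hAm' : DependsBelow m Aᶜ := fun y y' h => not_congr (hAm y y' h)
  obtain ⟨l1, l2⟩ := condProb_lower_bound hb hρ ha hharnack hA hAm hmn hn hΘ hi (his.trans hs)
    (fun x hx hxΘ => (hc x hx hxΘ).1) k
  obtain ⟨u1, u2⟩ := condProb_lower_bound hb hρ ha hharnack hA.compl hAm' hmn hn (c := 1 - s) hΘ
    (by linarith) (by linarith)
    (fun x hx hxΘ => by
      rw [condProb_compl hρ hA hn hx]; linarith [(hc x hx hxΘ).2]) k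
  have hIcc : ∀ x, 1 ≤ x → x ≤ Θ → condProb b ρ A (n + k) x ∈ Set.Icc i s := fun x hx hxΘ => by
    refine ⟨l1 x hx hxΘ, ?_⟩
    have := u1 x hx hxΘ
    rw [condProb_compl hρ hA (by omega) hx] at this
    linarith
  refine ⟨hIcc, ?_⟩
  set κ := Real.exp (-(a * Θ)) with hκ
  set η := Real.exp (a * (Θ / b ^ k)) - 1 with hη
  have hκ0 : 0 < κ := Real.exp_pos _
  have hκ1 : κ ≤ 1 := by
    rw [hκ, Real.exp_le_one_iff]
    have : 0 ≤ a * Θ := mul_nonneg ha (by linarith)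
    linarith
  have hpair : ∀ x x', 1 ≤ x → x ≤ Θ → 1 ≤ x' → x' ≤ Θ →
      condProb b ρ A (n + k) x' - condProb b ρ A (n + k) x ≤ (1 - κ) * (s - i) + κ * η := by
    intro x x' hx hxΘ hx' hxΘ'
    have b1 := hIcc x hx hxΘ
    have b2 := hIcc x' hx' hxΘ'
    -- Lower bounds propagate only upwards, so the order of the points decides whether to use `A` or
    -- its complement.
    rcases le_total x x' with h | h
    · have := u2 x x' hx h hxΘ'
      rw [condProb_compl hρ hA (by omega) hx, condProb_compl hρ hA (by omega) hx'] at this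
      nlinarith [mul_nonneg (sub_nonneg.2 hκ1) (sub_nonneg.2 b1.1)]
    · have := l2 x' x hx' h hxΘ
      nlinarith [mul_nonneg (sub_nonneg.2 hκ1) (sub_nonneg.2 b2.2)]
  set S : Set ℝ := condProb b ρ A (n + k) '' Set.Icc 1 Θ with hS
  have hne : S.Nonempty := ⟨_, 1, ⟨le_rfl, h1.2⟩, rfl⟩
  have hbb : BddBelow S := ⟨0, by rintro _ ⟨x, _, rfl⟩; exact condProb_nonneg _ _ _⟩
  have hba : BddAbove S := ⟨1, by rintro _ ⟨x, _, rfl⟩; exact condProb_le_one _ _ _⟩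
  refine ⟨sInf S, sSup S, ?_, ?_, ?_, fun x hx hxΘ => ⟨csInf_le hbb ⟨x, ⟨hx, hxΘ⟩, rfl⟩,
    le_csSup hba ⟨x, ⟨hx, hxΘ⟩, rfl⟩⟩⟩
  · exact le_csInf hne (by rintro _ ⟨x, _, rfl⟩; exact condProb_nonneg _ _ _)
  · exact csSup_le hne (by rintro _ ⟨x, _, rfl⟩; exact condProb_le_one _ _ _)
  · rw [sub_le_iff_le_add]
    refine csSup_le hne ?_
    rintro _ ⟨x', hx', rfl⟩
    rw [← sub_le_iff_le_add']
    refine le_csInf hne ?_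
    rintro _ ⟨x, hx, rfl⟩
    linarith [hpair x x' hx.1 hx.2 hx'.1 hx'.2]

lemma condProb_eventually_mem_Icc (hb : 2 ≤ b) (hρ : MFlat b ρ) (hA : MeasurableSet A)
    (hAm : DependsBelow m A) {Θ : ℝ} (hΘ : 2 ≤ Θ) {ε : ℝ} (hε : 0 < ε) :
    ∃ N, ∃ i, ∀ n ≥ N, ∀ x, 1 ≤ x → x ≤ Θ → condProb b ρ A n x ∈ Set.Icc i (i + ε) := by
  obtain ⟨a, ha, hharnack⟩ := exists_survProb_le_exp_mul hb hρ
  set κ := Real.exp (-(a * Θ)) with hκ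
  have hκ0 : 0 < κ := Real.exp_pos _
  have hκ1 : κ ≤ 1 := by
    rw [hκ, Real.exp_le_one_iff]
    have : 0 ≤ a * Θ := mul_nonneg ha (by linarith)
    linarith
  have hb1 : (1 : ℝ) < b := by exact_mod_cast hb
  have hlim : Tendsto (fun k : ℕ => Real.exp (a * (Θ / (b : ℝ) ^ k)) - 1) atTop (𝓝 0) := by
    have h1 : Tendsto (fun k : ℕ => a * (Θ / (b : ℝ) ^ k)) atTop (𝓝 (a * 0)) :=
      ((tendsto_pow_atTop_atTop_of_one_lt hb1).const_div_atTop Θ).const_mul a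
    have h2 := ((Real.continuous_exp.tendsto _).comp h1).sub_const 1
    simpa using h2
  have claim : ∀ j : ℕ, ∃ n i s, m ≤ n ∧ 1 ≤ n ∧ 0 ≤ i ∧ s ≤ 1 ∧ s - i ≤ (1 - κ / 2) ^ j ∧
      ∀ x, 1 ≤ x → x ≤ Θ → condProb b ρ A n x ∈ Set.Icc i s := by
    intro j
    induction j with
    | zero => exact ⟨max m 1, 0, 1, le_max_left _ _, le_max_right _ _, le_rfl, le_rfl, by simp,
        fun x _ _ => ⟨condProb_nonneg _ _ _, condProb_le_one _ _ _⟩⟩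
    | succ j ih =>
      obtain ⟨n, i, s, hmn, hn, hi, hs, hB, hc⟩ := ih
      set B := (1 - κ / 2) ^ j with hBdef
      have hB0 : 0 < B := pow_pos (by linarith) j
      -- An error of at most `B / 2` gives `(1 - κ) * B + κ * B / 2 = (1 - κ / 2) * B`.
      obtain ⟨k, hk⟩ := (hlim.eventually (ge_mem_nhds (half_pos hB0))).exists
      obtain ⟨i', s', hi', hs', hd, hc'⟩ :=
        (condProb_contraction hb hρ ha hharnack hA hAm hmn hn hΘ hi hs hc k).2
      refine ⟨n + k, i', s', by omega, by omega, hi', hs', hd.trans ?_, hc'⟩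
      rw [← hκ, pow_succ, ← hBdef]
      have e1 : (1 - κ) * (s - i) ≤ (1 - κ) * B := mul_le_mul_of_nonneg_left hB (by linarith)
      have e2 := mul_le_mul_of_nonneg_left hk hκ0.le
      linarith
  obtain ⟨j, hj⟩ := exists_pow_lt_of_lt_one hε (show 1 - κ / 2 < 1 by linarith)
  obtain ⟨n, i, s, hmn, hn, hi, hs, hB, hc⟩ := claim j
  refine ⟨n, i, fun n' hn' x hx hxΘ => ?_⟩
  obtain ⟨k, rfl⟩ := Nat.exists_eq_add_of_le hn'
  have := (condProb_contraction hb hρ ha hharnack hA hAm hmn hn hΘ hi hs hc k).1 x hx hxΘ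
  exact ⟨this.1, this.2.trans (by linarith)⟩

lemma exists_tendsto_condProb (hb : 2 ≤ b) (hρ : MFlat b ρ) (hA : MeasurableSet A)
    (hAm : DependsBelow m A) :
    ∃ l : ℝ, ∀ θ : ℝ, 1 ≤ θ → Tendsto (fun n => condProb b ρ A n θ) atTop (𝓝 l) := by
  have hcauchy : CauchySeq fun n => condProb b ρ A n 1 := by
    rw [Metric.cauchySeq_iff']
    intro ε hε
    obtain ⟨N, i, h⟩ := condProb_eventually_mem_Icc hb hρ hA hAm le_rfl (half_pos hε)
    refine ⟨N, fun n hn => ?_⟩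
    have h1 := h n hn 1 le_rfl one_le_two
    have h2 := h N le_rfl 1 le_rfl one_le_two
    rw [Real.dist_eq, abs_lt]
    constructor <;> linarith [h1.1, h1.2, h2.1, h2.2]
  obtain ⟨l, hl⟩ := cauchySeq_tendsto_of_complete hcauchy
  refine ⟨l, fun θ hθ => ?_⟩
  refine hl.congr_dist ?_
  rw [Metric.tendsto_atTop]
  intro ε hε
  obtain ⟨N, i, h⟩ := condProb_eventually_mem_Icc hb hρ hA hAm (le_max_left 2 θ) (half_pos hε)
  refine ⟨N, fun n hn => ?_⟩
  have h1 := h n hn 1 le_rfl (one_le_two.trans (le_max_left _ _))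
  have h2 := h n hn θ hθ (le_max_right _ _)
  rw [Real.dist_0_eq_abs, abs_of_nonneg dist_nonneg, Real.dist_eq, abs_lt]
  constructor <;> linarith [h1.1, h1.2, h2.1, h2.2]

/-- Conditional probabilities are dominated by unconditional ones, uniformly in `n`. -/
lemma condProb_le_mul (hb : 2 ≤ b) (hρ : MFlat b ρ) (hA : MeasurableSet A)
    (hAm : DependsBelow m A) {n : ℕ} (hmn : m + 1 ≤ n) {θ : ℝ} (hθ : 1 ≤ θ) :
    condProb b ρ A n θ ≤ (topMass b ρ ^ m)⁻¹ * (iidLaw ρ).real A := by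
  have hp := pow_pos (topMass_pos hρ) m
  set c := (topMass b ρ ^ m)⁻¹ * (iidLaw ρ).real A with hc
  -- The inequality holds at `n = m + 1` by `topMass_pow_le_survProb` and is preserved by the
  -- positive linear operator `step`.
  suffices h : ∀ x, 1 ≤ x → x ≤ max 2 θ → 0 ≤ c * survProb b ρ n x - surv b ρ A n x by
    rw [condProb, div_le_iff₀ (survProb_pos hρ (by omega) hθ)]
    linarith [h θ hθ (le_max_right _ _)]
  induction n, hmn using Nat.le_induction with
  | base =>
    intro x hx _
    have h1 : surv b ρ A (m + 1) x ≤ (iidLaw ρ).real A := measureReal_mono Set.inter_subset_left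
    have h2 := topMass_pow_le_survProb (b := b) (ρ := ρ) m hx
    have h3 : (iidLaw ρ).real A = c * topMass b ρ ^ m := by rw [hc]; field_simp
    have h4 : c * topMass b ρ ^ m ≤ c * survProb b ρ (m + 1) x := by gcongr
    linarith
  | succ n hmn ih =>
    intro x hx hxΘ
    have := step_add_mul (b := b) (ρ := ρ) (measurable_surv (b := b) (ρ := ρ) Set.univ n)
      (abs_surv_le Set.univ n) (measurable_surv (b := b) (ρ := ρ) A n) (abs_surv_le A n) c (-1) x
    simp only [one_mul, neg_mul, ← sub_eq_add_neg] at this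
    rw [surv_succ b ρ hA hAm (by omega) (by omega), survProb_succ (by omega), ← this]
    exact step_nonneg hb (le_max_left _ _) ih hxΘ

end convergence

/-! ### Existence and uniqueness of the limit law -/

section existence

variable {b : ℕ} {ρ : Measure I} [IsProbabilityMeasure ρ]

lemma dependsBelow_cylinder (s : Finset ℕ) (S : Set (s → I)) :
    DependsBelow (s.sup id + 1) (cylinder s S) := by
  intro y y' h
  have : s.restrict y = s.restrict y' := by
    funext i
    exact h i (Nat.lt_succ_of_le (Finset.le_sup (f := id) i.2))
  rw [mem_cylinder, mem_cylinder, this]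

lemma condLaw_real (θ : ℝ) (n : ℕ) (A : Set (ℕ → I)) :
    (condLaw b ρ θ n).real A = condProb b ρ A n θ := by
  rw [condLaw, condProb, surv, survProb, surv, measureReal_def,
    cond_apply (measurableSet_condEvent b θ n), ENNReal.toReal_mul, ENNReal.toReal_inv,
    Set.univ_inter, Set.inter_comm A, div_eq_inv_mul]
  rfl

lemma iidLaw_condEvent_ne_zero (hρ : MFlat b ρ) {θ : ℝ} (hθ : 1 ≤ θ) {n : ℕ} (hn : 1 ≤ n) :
    iidLaw ρ (condEvent b θ n) ≠ 0 := by
  intro h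
  have := survProb_pos hρ hn hθ
  rw [survProb, surv, Set.univ_inter, measureReal_def, h] at this
  simp at this

lemma isProbabilityMeasure_condLaw (hρ : MFlat b ρ) {θ : ℝ} (hθ : 1 ≤ θ) {n : ℕ} (hn : 1 ≤ n) :
    IsProbabilityMeasure (condLaw b ρ θ n) :=
  cond_isProbabilityMeasure (iidLaw_condEvent_ne_zero hρ hθ hn)

lemma condLaw_eq_ofReal (θ : ℝ) (n : ℕ) (A : Set (ℕ → I)) :
    condLaw b ρ θ n A = ENNReal.ofReal (condProb b ρ A n θ) := by
  have : IsFiniteMeasure (condLaw b ρ θ n) := by unfold condLaw; infer_instance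
  rw [← condLaw_real, ofReal_measureReal]

lemma exists_tendsto_condLaw (hb : 2 ≤ b) (hρ : MFlat b ρ) {A : Set (ℕ → I)}
    (hA : A ∈ measurableCylinders fun _ : ℕ => I) :
    ∃ l : ℝ≥0∞, ∀ θ : ℝ, 1 ≤ θ → Tendsto (fun n => condLaw b ρ θ n A) atTop (𝓝 l) := by
  obtain ⟨s, S, hS, rfl⟩ := (mem_measurableCylinders A).1 hA
  obtain ⟨l, hl⟩ := exists_tendsto_condProb hb hρ hS.cylinder (dependsBelow_cylinder s S)
  refine ⟨ENNReal.ofReal l, fun θ hθ => ?_⟩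
  simp_rw [condLaw_eq_ofReal]
  exact ENNReal.tendsto_ofReal (hl θ hθ)

lemma condLaw_cylinder_le (hb : 2 ≤ b) (hρ : MFlat b ρ) (s : Finset ℕ) :
    ∃ C : ℝ≥0∞, C ≠ ∞ ∧ ∃ N, ∀ n ≥ N, ∀ S : Set (s → I), MeasurableSet S →
      condLaw b ρ 1 n (cylinder s S) ≤ C * (iidLaw ρ).map s.restrict S := by
  refine ⟨ENNReal.ofReal (topMass b ρ ^ (s.sup id + 1))⁻¹, ENNReal.ofReal_ne_top, s.sup id + 1 + 1,
    fun n hn S hS => ?_⟩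
  have h := condProb_le_mul hb hρ hS.cylinder (dependsBelow_cylinder s S) hn le_rfl
  rw [Measure.map_apply (Finset.measurable_restrict s) hS, condLaw_eq_ofReal]
  refine (ENNReal.ofReal_le_ofReal h).trans ?_
  rw [ENNReal.ofReal_mul (inv_nonneg.2 (pow_nonneg (topMass_pos hρ).le _)), ofReal_measureReal]
  rfl

/-- Weak limits control only open sets. Outer regularity of the i.i.d. marginals and the uniform
domination `condLaw_cylinder_le` extend the upper bound `P A ≤ l A` to all cylinders; complements
then force equality. -/
lemma exists_isLimitLaw (hb : 2 ≤ b) (hρ : MFlat b ρ) : ∃ P, IsLimitLaw b ρ P := by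
  choose! l hl using fun (A : Set (ℕ → I)) (hA : A ∈ measurableCylinders fun _ : ℕ => I) =>
    exists_tendsto_condLaw hb hρ hA
  have hl1 : ∀ A ∈ measurableCylinders (fun _ : ℕ => I),
      Tendsto (fun n => condLaw b ρ 1 (n + 1) A) atTop (𝓝 (l A)) := fun A hA =>
    (hl A hA 1 le_rfl).comp (tendsto_add_atTop_nat 1)
  have hprob : ∀ n, IsProbabilityMeasure (condLaw b ρ 1 (n + 1)) := fun n =>
    isProbabilityMeasure_condLaw hρ le_rfl (by omega)
  let μ : ℕ → ProbabilityMeasure (ℕ → I) := fun n => ⟨condLaw b ρ 1 (n + 1), hprob n⟩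
  let F : Ultrafilter ℕ := Ultrafilter.of atTop
  have hF : (F : Filter ℕ) ≤ atTop := Ultrafilter.of_le _
  -- Probability measures on the compact space `ℕ → I` form a compact space, so an ultrafilter limit
  -- exists.
  obtain ⟨P, hP⟩ : ∃ P : ProbabilityMeasure (ℕ → I), Tendsto μ F (𝓝 P) :=
    ⟨(F.map μ).lim, (F.map μ).le_nhds_lim⟩
  have hle : ∀ A ∈ measurableCylinders (fun _ : ℕ => I), (P : Measure (ℕ → I)) A ≤ l A := by
    intro A hA
    obtain ⟨s, S, hS, rfl⟩ := (mem_measurableCylinders A).1 hA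
    obtain ⟨C, hC, N, hN⟩ := condLaw_cylinder_le hb hρ s
    have : IsProbabilityMeasure ((iidLaw ρ).map s.restrict) :=
      Measure.isProbabilityMeasure_map (Finset.measurable_restrict s).aemeasurable
    refine ENNReal.le_of_forall_pos_le_add fun ε hε _ => ?_
    have hεC : (ε : ℝ≥0∞) / C ≠ 0 := ENNReal.div_ne_zero.2 ⟨by simpa using hε.ne', hC⟩
    obtain ⟨U, hSU, hU, -, hUS⟩ := hS.exists_isOpen_sdiff_lt (μ := (iidLaw ρ).map s.restrict)
      (measure_ne_top _ _) hεC
    have hUc : cylinder s U ∈ measurableCylinders fun _ : ℕ => I :=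
      (mem_measurableCylinders _).2 ⟨s, U, hU.measurableSet, rfl⟩
    have hUo : IsOpen (cylinder (α := fun _ : ℕ => I) s U) :=
      hU.preimage (Finset.continuous_restrict s)
    calc (P : Measure (ℕ → I)) (cylinder s S)
        ≤ (P : Measure (ℕ → I)) (cylinder s U) := measure_mono (Set.preimage_mono hSU)
      _ ≤ liminf (fun n => (μ n : Measure (ℕ → I)) (cylinder s U)) F :=
          ProbabilityMeasure.le_liminf_measure_open_of_tendsto hP hUo
      _ = l (cylinder s U) := ((hl1 _ hUc).mono_left hF).liminf_eq
      _ ≤ l (cylinder s S) + ε := by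
          refine le_of_tendsto_of_tendsto (hl _ hUc 1 le_rfl)
            ((hl _ hA 1 le_rfl).add_const (ε : ℝ≥0∞)) ?_
          filter_upwards [eventually_ge_atTop N] with n hn
          have hsub : cylinder (α := fun _ : ℕ => I) s U ⊆ cylinder s S ∪ cylinder s (U \ S) := by
            rw [union_cylinder_same]
            exact Set.preimage_mono (by simp)
          refine (measure_mono hsub).trans ((measure_union_le _ _).trans ?_)
          gcongr
          refine (hN n hn _ (hU.measurableSet.diff hS)).trans ?_
          exact (mul_le_mul_right hUS.le C).trans ENNReal.mul_div_le
  refine ⟨P, inferInstance, fun θ hθ A hA => ?_⟩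
  have hAm := MeasurableSet.of_mem_measurableCylinders hA
  have hAc := compl_mem_measurableCylinders hA
  have hsum : l A + l Aᶜ = 1 := by
    refine tendsto_nhds_unique ((hl1 A hA).add (hl1 _ hAc)) ?_
    simp_rw [prob_add_prob_compl hAm]
    exact tendsto_const_nhds
  have hPA : (P : Measure (ℕ → I)) A + (P : Measure (ℕ → I)) Aᶜ = 1 := prob_add_prob_compl hAm
  have : (P : Measure (ℕ → I)) A = l A := by
    refine le_antisymm (hle A hA) ?_
    have h1 : l A + (P : Measure (ℕ → I)) Aᶜ
        ≤ (P : Measure (ℕ → I)) A + (P : Measure (ℕ → I)) Aᶜ := by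
      rw [hPA, ← hsum]; gcongr; exact hle _ hAc
    exact (ENNReal.add_le_add_iff_right (measure_ne_top _ _)).1 h1
  rw [this]
  exact hl A hA θ hθ

lemma IsLimitLaw.unique {P P' : Measure (ℕ → I)} (hP : IsLimitLaw b ρ P)
    (hP' : IsLimitLaw b ρ P') : P = P' := by
  have := hP.1
  have := hP'.1
  refine ext_of_generate_finite _ (generateFrom_measurableCylinders (α := fun _ : ℕ => I)).symm
    isPiSystem_measurableCylinders (fun A hA => ?_) (by simp)
  exact tendsto_nhds_unique (hP.2 1 le_rfl A hA) (hP'.2 1 le_rfl A hA)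

end existence

/-! ### Partial sums of `Qinf` -/

section partialSums

variable {b : ℕ}

/-- The partial sums of the series defining `Qinf`. -/
noncomputable def partialQ (b m : ℕ) (y : ℕ → I) : ℝ :=
  ∑ i ∈ Finset.range m, (y i : ℝ) / (b : ℝ) ^ i

lemma measurable_partialQ (b m : ℕ) : Measurable (partialQ b m) := by
  unfold partialQ; fun_prop

lemma summable_Qinf (hb : 2 ≤ b) (y : ℕ → I) : Summable fun k : ℕ => (y k : ℝ) / (b : ℝ) ^ k := by
  have hb1 : (1 : ℝ) < b := by exact_mod_cast hb
  refine Summable.of_nonneg_of_le (fun k => div_nonneg (y k).2.1 (by positivity)) (fun k => ?_)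
    (summable_geometric_of_lt_one (r := (b : ℝ)⁻¹) (by positivity) (inv_lt_one_of_one_lt₀ hb1))
  rw [inv_pow, ← one_div]
  gcongr
  exact (y k).2.2

lemma tendsto_partialQ (hb : 2 ≤ b) (y : ℕ → I) :
    Tendsto (fun m => partialQ b m y) atTop (𝓝 (Qinf b y)) :=
  (summable_Qinf hb y).hasSum.tendsto_sum_nat

lemma measurable_Qinf (hb : 2 ≤ b) : Measurable (Qinf b) :=
  measurable_of_tendsto_metrizable (measurable_partialQ b)
    (tendsto_pi_nhds.2 fun y => tendsto_partialQ hb y)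

lemma Qinf_cons (hb : 2 ≤ b) (z : I) (y : ℕ → I) : Qinf b (cons z y) = z + Qinf b y / b := by
  unfold Qinf
  rw [(summable_Qinf hb (cons z y)).tsum_eq_zero_add, ← tsum_div_const]
  simp only [cons, pow_zero, div_one, pow_succ, div_div]

lemma monotone_partialQ (y : ℕ → I) : Monotone fun m => partialQ b m y := by
  refine monotone_nat_of_le_succ fun m => ?_
  simp only [partialQ, Finset.sum_range_succ]
  have : 0 ≤ (y m : ℝ) / (b : ℝ) ^ m := div_nonneg (y m).2.1 (by positivity)
  linarith

/-- The constant 2 works because `1 / b ^ m + 2 / b ^ (m + 1) ≤ 2 / b ^ m` for `b ≥ 2`; it bounds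
the tail and the boundary term together. -/
lemma antitone_partialQ_add (hb : 2 ≤ b) (y : ℕ → I) :
    Antitone fun m => partialQ b m y + 2 / (b : ℝ) ^ m := by
  have hb' : (2 : ℝ) ≤ b := by exact_mod_cast hb
  refine antitone_nat_of_succ_le fun m => ?_
  simp only [partialQ, Finset.sum_range_succ]
  have h1 : (y m : ℝ) / (b : ℝ) ^ m ≤ 1 / (b : ℝ) ^ m := by gcongr; exact (y m).2.2
  have h2 : 2 / (b : ℝ) ^ (m + 1) ≤ 1 / (b : ℝ) ^ m := by
    rw [pow_succ, div_le_div_iff₀ (by positivity) (by positivity)]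
    nlinarith [pow_pos (show (0 : ℝ) < b by linarith) m]
  have h3 : 2 / (b : ℝ) ^ m = 1 / (b : ℝ) ^ m + 1 / (b : ℝ) ^ m := by ring
  linarith

lemma Q_zero_eq (θ : ℝ) (n : ℕ) (y : ℕ → I) :
    Q b θ n 0 y = partialQ b n y + θ / (b : ℝ) ^ n := by
  simp [Q, partialQ]

lemma partialQ_le_Q {m n : ℕ} (hmn : m ≤ n) (y : ℕ → I) : partialQ b m y ≤ Q b 1 n 0 y := by
  rw [Q_zero_eq]
  have : (0 : ℝ) ≤ 1 / (b : ℝ) ^ n := by positivity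
  linarith [monotone_partialQ (b := b) y hmn]

lemma Q_le_partialQ_add (hb : 2 ≤ b) {m n : ℕ} (hmn : m ≤ n) (y : ℕ → I) :
    Q b 1 n 0 y ≤ partialQ b m y + 2 / (b : ℝ) ^ m := by
  refine le_trans ?_ (antitone_partialQ_add hb y hmn)
  simp only [Q_zero_eq]
  gcongr
  norm_num

lemma partialQ_le_Qinf (hb : 2 ≤ b) (m : ℕ) (y : ℕ → I) : partialQ b m y ≤ Qinf b y :=
  (monotone_partialQ y).ge_of_tendsto (tendsto_partialQ hb y) m

lemma tendsto_partialQ_add (hb : 2 ≤ b) (y : ℕ → I) :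
    Tendsto (fun m => partialQ b m y + 2 / (b : ℝ) ^ m) atTop (𝓝 (Qinf b y)) := by
  have hb1 : (1 : ℝ) < b := by exact_mod_cast hb
  simpa using (tendsto_partialQ hb y).add
    ((tendsto_pow_atTop_atTop_of_one_lt hb1).const_div_atTop 2)

lemma setOf_partialQ_mem_measurableCylinders (b m : ℕ) {S : Set ℝ} (hS : MeasurableSet S) :
    {y | partialQ b m y ∈ S} ∈ measurableCylinders fun _ : ℕ => I := by
  rw [mem_measurableCylinders]
  refine ⟨Finset.range m,
    {v | ∑ i : Finset.range m, (v i : ℝ) / (b : ℝ) ^ (i : ℕ) ∈ S}, ?_, ?_⟩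
  · exact measurableSet_preimage (by fun_prop) hS
  · ext y
    simp only [partialQ, Set.mem_ofPred_eq, mem_cylinder, Finset.restrict_def]
    rw [Finset.sum_coe_sort (Finset.range m) fun i => (y i : ℝ) / (b : ℝ) ^ i]

end partialSums

/-! ### The first coordinate and the shift -/

section shift

variable {b : ℕ} {ρ : Measure I} [IsProbabilityMeasure ρ]

lemma shift_preimage_mem_measurableCylinders {A : Set (ℕ → I)}
    (hA : A ∈ measurableCylinders fun _ : ℕ => I) :
    shift ⁻¹' A ∈ measurableCylinders fun _ : ℕ => I := by
  classical
  obtain ⟨s, S, hS, rfl⟩ := (mem_measurableCylinders A).1 hA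
  rw [mem_measurableCylinders]
  refine ⟨s.image Nat.succ, (fun v (i : s) => v ⟨i + 1, Finset.mem_image_of_mem _ i.2⟩) ⁻¹' S,
    ?_, rfl⟩
  exact measurableSet_preimage (by fun_prop) hS

lemma eval_zero_preimage_mem_measurableCylinders {B : Set I} (hB : MeasurableSet B) :
    {y : ℕ → I | y 0 ∈ B} ∈ measurableCylinders fun _ : ℕ => I := by
  rw [mem_measurableCylinders]
  refine ⟨{0}, (fun v => v ⟨0, Finset.mem_singleton_self 0⟩) ⁻¹' B, ?_, rfl⟩
  exact measurableSet_preimage (by fun_prop) hB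

lemma iidLaw_inter_shift {B : Set I} (hB : MeasurableSet B) {C : Set (ℕ → I)}
    (hC : MeasurableSet C) :
    iidLaw ρ ({y | y 0 ∈ B} ∩ shift ⁻¹' C) = ρ B * iidLaw ρ C := by
  conv_lhs => rw [← map_cons_iidLaw ρ]
  have h0 : MeasurableSet {y : ℕ → I | y 0 ∈ B} := measurable_pi_apply 0 hB
  rw [Measure.map_apply measurable_cons (h0.inter (measurable_shift hC)), ← Measure.prod_prod]
  rfl

lemma iidLaw_shift {C : Set (ℕ → I)} (hC : MeasurableSet C) :
    iidLaw ρ (shift ⁻¹' C) = iidLaw ρ C := by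
  simpa using iidLaw_inter_shift (ρ := ρ) MeasurableSet.univ hC

/-- The event that `1 ≤ Q_{n,k}` for all zero-based `k < n`. -/
def fullEvent (b : ℕ) (θ : ℝ) (n : ℕ) : Set (ℕ → I) := {y | ∀ k < n, 1 ≤ Q b θ n k y}

lemma Q_shift (θ : ℝ) (n k : ℕ) (y : ℕ → I) : Q b θ n k (shift y) = Q b θ (n + 1) (k + 1) y := by
  simp only [Q, shift, Nat.add_sub_add_right]
  congr 1
  exact Finset.sum_congr rfl fun i _ => by rw [add_right_comm]

lemma condEvent_succ_eq_shift (θ : ℝ) (n : ℕ) :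
    condEvent b θ (n + 1) = shift ⁻¹' fullEvent b θ n := by
  ext y
  simp only [condEvent, fullEvent, Set.mem_ofPred_eq, Set.mem_preimage, Q_shift]
  constructor
  · intro h k hk
    exact h (k + 1) (by omega) (by omega)
  · intro h k h1 h2
    obtain ⟨k, rfl⟩ : ∃ j, k = j + 1 := ⟨k - 1, by omega⟩
    exact h k (by omega)

lemma fullEvent_eq (θ : ℝ) {n : ℕ} (hn : 1 ≤ n) :
    fullEvent b θ n = condEvent b θ n ∩ {y | 1 ≤ Q b θ n 0 y} := by
  ext y
  simp only [condEvent, fullEvent, Set.mem_ofPred_eq, Set.mem_inter_iff]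
  refine ⟨fun h => ⟨fun k _ hk => h k hk, h 0 hn⟩, fun h k hk => ?_⟩
  rcases Nat.eq_zero_or_pos k with rfl | h0
  · exact h.2
  · exact h.1 k h0 hk

lemma measurableSet_fullEvent (b : ℕ) (θ : ℝ) (n : ℕ) : MeasurableSet (fullEvent b θ n) := by
  have : fullEvent b θ n = ⋂ k : ℕ, ⋂ (_ : k < n), {y | 1 ≤ Q b θ n k y} := by
    ext y; simp [fullEvent]
  rw [this]
  exact MeasurableSet.iInter fun k => MeasurableSet.iInter fun _ =>
    measurableSet_le measurable_const (measurable_Q b θ n k)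

/-- Under the conditioned law, the first coordinate is independent of the others, with law `ρ`. -/
lemma condLaw_succ_inter_shift (θ : ℝ) (n : ℕ) {B : Set I} (hB : MeasurableSet B)
    {A : Set (ℕ → I)} (hA : MeasurableSet A) :
    condLaw b ρ θ (n + 1) ({y | y 0 ∈ B} ∩ shift ⁻¹' A) =
      ρ B * condLaw b ρ θ (n + 1) (shift ⁻¹' A) := by
  rw [condLaw, cond_apply (measurableSet_condEvent _ _ _), cond_apply (measurableSet_condEvent _ _ _),
    condEvent_succ_eq_shift, Set.inter_left_comm, ← Set.preimage_inter,
    iidLaw_inter_shift hB ((measurableSet_fullEvent _ _ _).inter hA),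
    iidLaw_shift ((measurableSet_fullEvent _ _ _).inter hA), mul_left_comm]

/-- The conditioned laws at consecutive times: the shift has the law further conditioned on
`1 ≤ Q_{n,0}`. -/
lemma condLaw_succ_shift_mul (hρ : MFlat b ρ) {θ : ℝ} (hθ : 1 ≤ θ) {n : ℕ} (hn : 1 ≤ n)
    {A : Set (ℕ → I)} (hA : MeasurableSet A) :
    condLaw b ρ θ (n + 1) (shift ⁻¹' A) * condLaw b ρ θ n {y | 1 ≤ Q b θ n 0 y} =
      condLaw b ρ θ n (A ∩ {y | 1 ≤ Q b θ n 0 y}) := by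
  have h0 := iidLaw_condEvent_ne_zero hρ hθ (n := n + 1) (by omega)
  simp only [condLaw]
  rw [cond_apply (measurableSet_condEvent _ _ _), cond_apply (measurableSet_condEvent _ _ _),
    cond_apply (measurableSet_condEvent _ _ _)]
  rw [condEvent_succ_eq_shift, iidLaw_shift (measurableSet_fullEvent _ _ _)] at h0
  rw [condEvent_succ_eq_shift, ← Set.preimage_inter, iidLaw_shift (measurableSet_fullEvent _ _ _),
    iidLaw_shift ((measurableSet_fullEvent _ _ _).inter hA), Set.inter_comm A, ← Set.inter_assoc,
    ← fullEvent_eq θ hn]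
  rw [mul_mul_mul_comm, mul_comm (iidLaw ρ (fullEvent b θ n))⁻¹, mul_assoc, mul_comm (iidLaw ρ _)
    (iidLaw ρ (fullEvent b θ n)), ← mul_assoc (iidLaw ρ (fullEvent b θ n))⁻¹,
    ENNReal.inv_mul_cancel h0 (measure_ne_top _ _), one_mul]

lemma topMass_le_condLaw (hρ : MFlat b ρ) {n : ℕ} (hn : 1 ≤ n) :
    ENNReal.ofReal (topMass b ρ) ≤ condLaw b ρ 1 n {y | 1 ≤ Q b 1 n 0 y} := by
  rw [condLaw_eq_ofReal]
  refine ENNReal.ofReal_le_ofReal ?_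
  rw [condProb, le_div_iff₀ (survProb_pos hρ hn le_rfl)]
  refine (topMass_mul_survProb_le hn le_rfl).trans_eq ?_
  rw [survProb, surv, surv, Set.univ_inter, condEvent_succ_eq_shift, measureReal_def,
    iidLaw_shift (measurableSet_fullEvent _ _ _), fullEvent_eq 1 hn, Set.inter_comm,
    measureReal_def]

end shift

/-! ### The distributional fixed point -/

section limit

variable {b : ℕ} {ρ : Measure I} [IsProbabilityMeasure ρ] {P : Measure (ℕ → I)}

lemma IsLimitLaw.map_cons (hP : IsLimitLaw b ρ P) :
    (ρ.prod (P.map shift)).map (fun p : I × (ℕ → I) => cons p.1 p.2) = P := by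
  have := hP.1
  have hms : IsProbabilityMeasure (P.map shift) :=
    Measure.isProbabilityMeasure_map measurable_shift.aemeasurable
  have hcyl : ∀ B : Set I, MeasurableSet B → ∀ A ∈ measurableCylinders (fun _ : ℕ => I),
      P ({y | y 0 ∈ B} ∩ shift ⁻¹' A) = ρ B * P (shift ⁻¹' A) := by
    intro B hB A hA
    have hsA := shift_preimage_mem_measurableCylinders hA
    have h1 := (hP.2 1 le_rfl _ (inter_mem_measurableCylinders
      (eval_zero_preimage_mem_measurableCylinders hB) hsA)).comp (tendsto_add_atTop_nat 1)
    have h2 := ENNReal.Tendsto.const_mul (a := ρ B)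
      ((hP.2 1 le_rfl _ hsA).comp (tendsto_add_atTop_nat 1)) (Or.inr (measure_ne_top _ _))
    refine tendsto_nhds_unique h1 (h2.congr fun n => ?_)
    exact (condLaw_succ_inter_shift 1 n hB (MeasurableSet.of_mem_measurableCylinders hA)).symm
  have hmeas : ∀ B : Set I, MeasurableSet B → ∀ A, MeasurableSet A →
      P ({y | y 0 ∈ B} ∩ shift ⁻¹' A) = ρ B * P (shift ⁻¹' A) := by
    intro B hB A hA
    -- With `B` fixed, both sides are finite measures in `A`, so agreement on cylinders suffices.
    have key : (P.restrict {y | y 0 ∈ B}).map shift = ρ B • P.map shift := by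
      have hfin : IsFiniteMeasure ((P.restrict {y | y 0 ∈ B}).map shift) := inferInstance
      have hap : ∀ A, MeasurableSet A → (P.restrict {y | y 0 ∈ B}).map shift A
          = P ({y | y 0 ∈ B} ∩ shift ⁻¹' A) := fun A hA => by
        rw [Measure.map_apply measurable_shift hA, Measure.restrict_apply (measurable_shift hA),
          Set.inter_comm]
      refine ext_of_generate_finite _ (generateFrom_measurableCylinders (α := fun _ : ℕ => I)).symm
        isPiSystem_measurableCylinders (fun A hA => ?_) ?_
      · have hAm := MeasurableSet.of_mem_measurableCylinders hA
        rw [hap A hAm, hcyl B hB A hA, Measure.smul_apply, smul_eq_mul,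
          Measure.map_apply measurable_shift hAm]
      · rw [hap _ MeasurableSet.univ, hcyl B hB _ (univ_mem_measurableCylinders _),
          Measure.smul_apply, smul_eq_mul, Measure.map_apply measurable_shift MeasurableSet.univ]
    have := congrArg (fun μ : Measure (ℕ → I) => μ A) key
    simp only [Measure.smul_apply, smul_eq_mul] at this
    rw [Measure.map_apply measurable_shift hA, Measure.map_apply measurable_shift hA,
      Measure.restrict_apply (measurable_shift hA), Set.inter_comm] at this
    exact this
  have hpair : Measurable fun y : ℕ → I => (y 0, shift y) :=
    (measurable_pi_apply 0).prodMk measurable_shift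
  have hprod : ρ.prod (P.map shift) = P.map fun y => (y 0, shift y) := by
    refine Measure.prod_eq fun B A hB hA => ?_
    rw [Measure.map_apply hpair (hB.prod hA), Measure.map_apply measurable_shift hA,
      ← hmeas B hB A hA]
    rfl
  rw [hprod, Measure.map_map measurable_cons hpair]
  convert Measure.map_id
  funext y
  exact cons_shift y

/-- Given the shifted sequence, `Qinf` is a constant plus an independent variable of the atomless
law `ρ`. -/
lemma IsLimitLaw.measure_Qinf_eq_one (hb : 2 ≤ b) (hρ : MFlat b ρ) (hP : IsLimitLaw b ρ P) :
    P {y | Qinf b y = 1} = 0 := by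
  have := hP.1
  have hms : IsProbabilityMeasure (P.map shift) :=
    Measure.isProbabilityMeasure_map measurable_shift.aemeasurable
  have hm : MeasurableSet {y | Qinf b y = 1} := measurable_Qinf hb (measurableSet_singleton 1)
  rw [← hP.map_cons, Measure.map_apply measurable_cons hm,
    Measure.prod_apply_symm (measurable_cons hm)]
  refine (lintegral_congr fun y => ?_).trans lintegral_zero
  have : (fun z => (z, y)) ⁻¹' ((fun p : I × (ℕ → I) => cons p.1 p.2) ⁻¹' {y | Qinf b y = 1})
      = {z : I | (z : ℝ) = 1 - Qinf b y / b} := by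
    ext z
    simp only [Set.mem_preimage, Set.mem_ofPred_eq, Qinf_cons hb, eq_sub_iff_add_eq]
  rw [this, hρ.measure_coe_eq_zero]

/-- The event varies with `n`, so `IsLimitLaw` does not apply directly. For `n ≥ m` it lies between
the fixed cylinders given by `partialQ b m` and `partialQ b m + 2 / b ^ m`, whose probabilities have
the same limit in `m`. -/
lemma IsLimitLaw.tendsto_inter_Q (hb : 2 ≤ b) (hρ : MFlat b ρ) (hP : IsLimitLaw b ρ P)
    {A : Set (ℕ → I)} (hA : A ∈ measurableCylinders fun _ : ℕ => I) :
    Tendsto (fun n => condLaw b ρ 1 n (A ∩ {y | 1 ≤ Q b 1 n 0 y})) atTop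
      (𝓝 (P (A ∩ {y | 1 ≤ Qinf b y}))) := by
  have := hP.1
  have hAm := MeasurableSet.of_mem_measurableCylinders hA
  have hU : ∀ m, A ∩ {y | 1 ≤ partialQ b m y} ∈ measurableCylinders fun _ : ℕ => I := fun m =>
    inter_mem_measurableCylinders hA
      (setOf_partialQ_mem_measurableCylinders b m (S := Set.Ici 1) measurableSet_Ici)
  have hV : ∀ m, A ∩ {y | 1 ≤ partialQ b m y + 2 / (b : ℝ) ^ m} ∈
      measurableCylinders fun _ : ℕ => I := fun m =>
    inter_mem_measurableCylinders hA
      (setOf_partialQ_mem_measurableCylinders b m (S := {x | 1 ≤ x + 2 / (b : ℝ) ^ m})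
        (measurableSet_le measurable_const (by fun_prop)))
  have hUlim : Tendsto (fun m => P (A ∩ {y | 1 ≤ partialQ b m y})) atTop
      (𝓝 (P (A ∩ {y | 1 ≤ Qinf b y}))) := by
    have h1 := tendsto_measure_iUnion_atTop (μ := P) (s := fun m => A ∩ {y | 1 ≤ partialQ b m y})
      fun m m' hm => Set.inter_subset_inter_right _ fun y (hy : 1 ≤ _) =>
        hy.trans (monotone_partialQ y hm)
    suffices h : P (A ∩ {y | 1 ≤ Qinf b y}) = P (⋃ m, A ∩ {y | 1 ≤ partialQ b m y}) by
      rw [h]; exact h1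
    refine le_antisymm ?_ (measure_mono (Set.iUnion_subset fun m =>
      Set.inter_subset_inter_right _ fun y (hy : 1 ≤ _) => hy.trans (partialQ_le_Qinf hb m y)))
    -- Partial sums reach 1 only where `Qinf > 1`, or possibly on the null set `Qinf = 1`.
    have hsub : A ∩ {y | 1 ≤ Qinf b y} ⊆
        (⋃ m, A ∩ {y | 1 ≤ partialQ b m y}) ∪ {y | Qinf b y = 1} := by
      rintro y ⟨hyA, hy⟩
      rcases (show 1 ≤ Qinf b y from hy).eq_or_lt with h | h
      · exact Or.inr h.symm
      · obtain ⟨m, hm⟩ := ((tendsto_partialQ hb y).eventually (lt_mem_nhds h)).exists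
        exact Or.inl (Set.mem_iUnion.2 ⟨m, hyA, hm.le⟩)
    refine (measure_mono hsub).trans ((measure_union_le _ _).trans_eq ?_)
    rw [hP.measure_Qinf_eq_one hb hρ, add_zero]
  have hVlim : Tendsto (fun m => P (A ∩ {y | 1 ≤ partialQ b m y + 2 / (b : ℝ) ^ m})) atTop
      (𝓝 (P (A ∩ {y | 1 ≤ Qinf b y}))) := by
    have h1 := tendsto_measure_iInter_atTop (μ := P)
      (s := fun m => A ∩ {y | 1 ≤ partialQ b m y + 2 / (b : ℝ) ^ m})
      (fun m => (MeasurableSet.of_mem_measurableCylinders (hV m)).nullMeasurableSet)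
      (fun m m' hm => Set.inter_subset_inter_right _ fun y (hy : 1 ≤ _) =>
        hy.trans (antitone_partialQ_add hb y hm)) ⟨0, measure_ne_top _ _⟩
    suffices h : A ∩ {y | 1 ≤ Qinf b y} =
        ⋂ m, A ∩ {y | 1 ≤ partialQ b m y + 2 / (b : ℝ) ^ m} by
      rw [h]; exact h1
    ext y
    simp only [Set.mem_inter_iff, Set.mem_ofPred_eq, Set.mem_iInter]
    constructor
    · rintro ⟨hyA, hy⟩ m
      exact ⟨hyA, hy.trans ((antitone_partialQ_add hb y).le_of_tendsto
        (tendsto_partialQ_add hb y) m)⟩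
    · intro h
      exact ⟨(h 0).1, ge_of_tendsto' (tendsto_partialQ_add hb y) fun m => (h m).2⟩
  refine tendsto_order.2 ⟨fun c hc => ?_, fun c hc => ?_⟩
  · obtain ⟨m, hm⟩ := (hUlim.eventually (lt_mem_nhds hc)).exists
    filter_upwards [(hP.2 1 le_rfl _ (hU m)).eventually (lt_mem_nhds hm), eventually_ge_atTop m]
      with n h1 h2
    exact h1.trans_le (measure_mono (Set.inter_subset_inter_right _ fun y (hy : 1 ≤ _) =>
      hy.trans (partialQ_le_Q h2 y)))
  · obtain ⟨m, hm⟩ := (hVlim.eventually (gt_mem_nhds hc)).exists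
    filter_upwards [(hP.2 1 le_rfl _ (hV m)).eventually (gt_mem_nhds hm), eventually_ge_atTop m]
      with n h1 h2
    exact (measure_mono (Set.inter_subset_inter_right _ fun y (hy : 1 ≤ _) =>
      hy.trans (Q_le_partialQ_add hb h2 y))).trans_lt h1

lemma IsLimitLaw.tendsto_Q (hb : 2 ≤ b) (hρ : MFlat b ρ) (hP : IsLimitLaw b ρ P) :
    Tendsto (fun n => condLaw b ρ 1 n {y | 1 ≤ Q b 1 n 0 y}) atTop
      (𝓝 (P {y | 1 ≤ Qinf b y})) := by
  simpa using hP.tendsto_inter_Q hb hρ (univ_mem_measurableCylinders _)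

/-- The finite-time probabilities are ratios of successive survival probabilities, bounded below by
`topMass` uniformly in `n`. -/
lemma IsLimitLaw.measure_one_le_Qinf_pos (hb : 2 ≤ b) (hρ : MFlat b ρ) (hP : IsLimitLaw b ρ P) :
    0 < P {y | 1 ≤ Qinf b y} := by
  refine (ENNReal.ofReal_pos.2 (topMass_pos hρ)).trans_le
    (ge_of_tendsto (hP.tendsto_Q hb hρ) ?_)
  filter_upwards [eventually_ge_atTop 1] with n hn using topMass_le_condLaw hρ hn

lemma IsLimitLaw.map_shift (hb : 2 ≤ b) (hρ : MFlat b ρ) (hP : IsLimitLaw b ρ P) :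
    P.map shift = P[|{y | 1 ≤ Qinf b y}] := by
  have := hP.1
  have hms : IsProbabilityMeasure (P.map shift) :=
    Measure.isProbabilityMeasure_map measurable_shift.aemeasurable
  have hpos := hP.measure_one_le_Qinf_pos hb hρ
  have hR : MeasurableSet {y | 1 ≤ Qinf b y} := measurableSet_le measurable_const (measurable_Qinf hb)
  have := cond_isProbabilityMeasure hpos.ne'
  refine ext_of_generate_finite _ (generateFrom_measurableCylinders (α := fun _ : ℕ => I)).symm
    isPiSystem_measurableCylinders (fun A hA => ?_) (by simp)
  have hAm := MeasurableSet.of_mem_measurableCylinders hA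
  have h1 := (hP.2 1 le_rfl _ (shift_preimage_mem_measurableCylinders hA)).comp
    (tendsto_add_atTop_nat 1)
  have h2 := ENNReal.Tendsto.mul h1 (Or.inr (measure_ne_top P _)) (hP.tendsto_Q hb hρ)
    (Or.inr (measure_ne_top P _))
  have h3 : P (shift ⁻¹' A) * P {y | 1 ≤ Qinf b y} = P (A ∩ {y | 1 ≤ Qinf b y}) := by
    refine tendsto_nhds_unique h2 ((hP.tendsto_inter_Q hb hρ hA).congr' ?_)
    filter_upwards [eventually_ge_atTop 1] with n hn
    exact (condLaw_succ_shift_mul hρ le_rfl hn hAm).symm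
  rw [Measure.map_apply measurable_shift hAm, cond_apply hR, Set.inter_comm, ← h3, mul_comm,
    mul_assoc, ENNReal.mul_inv_cancel hpos.ne' (measure_ne_top _ _), mul_one]

lemma cond_prod_snd {α β : Type*} [MeasurableSpace α] [MeasurableSpace β] (μ : Measure α)
    [IsProbabilityMeasure μ] (ν : Measure β) [IsFiniteMeasure ν] {R : Set β}
    (hR : MeasurableSet R) :
    (μ.prod ν)[|{p : α × β | p.2 ∈ R}] = μ.prod (ν[|R]) := by
  have hR' : {p : α × β | p.2 ∈ R} = Set.univ ×ˢ R := by ext; simp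
  refine (Measure.prod_eq fun s t _ _ => ?_).symm
  rw [hR', cond_apply (MeasurableSet.univ.prod hR), cond_apply hR, Set.prod_inter_prod,
    Set.univ_inter, Measure.prod_prod, Measure.prod_prod, measure_univ, one_mul, mul_left_comm]

lemma IsLimitLaw.map_Qinf (hb : 2 ≤ b) (hρ : MFlat b ρ) (hP : IsLimitLaw b ρ P) :
    ((ρ.prod P)[|{p : I × (ℕ → I) | 1 ≤ Qinf b p.2}]).map
        (fun p : I × (ℕ → I) => (p.1 : ℝ) + Qinf b p.2 / (b : ℝ)) = P.map (Qinf b) := by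
  have := hP.1
  have hR : MeasurableSet {y | 1 ≤ Qinf b y} := measurableSet_le measurable_const (measurable_Qinf hb)
  have h1 : (ρ.prod P)[|{p : I × (ℕ → I) | 1 ≤ Qinf b p.2}] = ρ.prod (P.map shift) := by
    rw [hP.map_shift hb hρ]
    exact cond_prod_snd ρ P hR
  rw [h1]
  conv_rhs => rw [← hP.map_cons, Measure.map_map (measurable_Qinf hb) measurable_cons]
  congr 1
  funext p
  exact (Qinf_cons hb p.1 p.2).symm

end limit

end Avalanche

theorem proposition3p6 (b : ℕ) (hb : 2 ≤ b) (ρ : Measure I) [IsProbabilityMeasure ρ]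
    (hρ : Avalanche.MFlat b ρ) :
    (∃! P : Measure (ℕ → I), Avalanche.IsLimitLaw b ρ P) ∧
    ∀ P : Measure (ℕ → I), Avalanche.IsLimitLaw b ρ P →
      0 < P {y | 1 ≤ Avalanche.Qinf b y} ∧
      ((ρ.prod P)[|{p : I × (ℕ → I) | 1 ≤ Avalanche.Qinf b p.2}]).map
          (fun p : I × (ℕ → I) => (p.1 : ℝ) + Avalanche.Qinf b p.2 / (b : ℝ))
        = P.map (Avalanche.Qinf b) := by
  obtain ⟨P, hP⟩ := Avalanche.exists_isLimitLaw hb hρ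
  exact ⟨⟨P, hP, fun P' hP' => hP'.unique hP⟩,
    fun P hP => ⟨hP.measure_one_le_Qinf_pos hb hρ, hP.map_Qinf hb hρ⟩⟩
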